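/- **Conventions.** All systems are finite dimensional with fixed orthonormal bases. A state is a positive semi-definite operator of trace one; a channel is a completely positive trace-preserving linear map. Alice holds the systems $A,\hat A$ and Bob holds $B,\hat B$. * For an integer $d\ge 1$, the swap channel on two $d$-dimensional systems $A,B$ is $\mathcal S^d_{AB}(\omega)=S\omega S^\dagger$ with $S=\sum_{i,j=0}^{d-1}|i\rangle\langle j|_A\otimes|j\rangle\langle i|_B$. * For an integer $d_{\hat A}\ge 2$ and $F\in[0,1]$, the isotropic state of fidelity $F$ and dimension $d_{\hat A}$ on $\hat A\hat B$ (with $d_{\hat B}=d_{\hat A}$) is $$\rho^{(F,d_{\hat A})}_{\hat A\hat B}=F\,\Phi_{\hat A\hat B}+(1-F)\frac{I_{\hat A\hat B}-\Phi_{\hat A\hat B}}{d_{\hat A}^2-1},\qquad \Phi_{\hat A\hat B}=\frac1{d_{\hat A}}\sum_{i,j}|i\rangle\langle j|_{\hat A}\otimes|i\rangle\langle j|_{\hat B}.$$ * The diamond distance of two channels with input system $C$ is $\|\mathcal N-\mathcal M\|_\diamond=\sup_{R,\rho_{RC}}\|(\mathrm{id}_R\otimes\mathcal N)(\rho_{RC})-(\mathrm{id}_R\otimes\mathcal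 M)(\rho_{RC})\|_1$, the supremum being over all finite-dimensional systems $R$ and all states $\rho_{RC}$, where $\|X\|_1=\operatorname{Tr}\sqrt{X^\dagger X}$. * A bipartite channel is LOCC if it is implemented by a protocol of finitely many rounds, in each of which one party applies a quantum instrument with finitely many outcomes to its own systems (possibly changing their dimension) and announces the outcome, on which all later operations may depend, and which ends with local channels of both parties. A bipartite channel $\mathcal P_{AB\to A'B'}$ is C-PPT-P (completely positive-partial-transpose preserving) if $T_{B'}\circ\mathcal P\circ T_B$ is completely positive, where $T$ denotes the transpose on Bob's systems. * For a resource state $\rho_{\hat A\hat B}$, the LOCC and PPT simulation errors of the swap channel are $$e_{\mathrm{LOCC}}(\mathcal S^d_{AB},\rho_{\hat A\hat B})=\inf_{\mathcal L}\tfrac12\big\|\mathcal S^d_{AB}-\mathcal L(\,\cdot\otimes\rho_{\hat A\hat B})\big\|_\diamond,\qquad e_{\mathrm{PPT}}(\mathcal S^d_{AB},\rho_{\hat A\hat B})=\inf_{\mathcal P}\tfrac12\big\|\mathcal S^d_{AB}-\mathcal P(\,\cdot\otimes\rho_{\hat A\hat B})\big\|_\diamond,$$ where $\mathcal L$ and $\mathcal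 P$ range over the channels $AB\hat A\hat B\to AB$ (Alice: $A\hat A\to A$, Bob: $B\hat B\to B$) that are LOCC and C-PPT-P, respectively. **Proposition.** Let $d\ge 1$ and $d_{\hat A}\ge 2$ be integers and $F\in[0,1]$. Then $$e_{\mathrm{PPT}}\big(\mathcal S^d_{AB},\rho^{(F,d_{\hat A})}_{\hat A\hat B}\big)=\begin{cases}1-\dfrac1{d^2}&\text{if }F\le\dfrac1{d_{\hat A}},\\[2mm] 1-\dfrac{F d_{\hat A}}{d^2}&\text{if }F>\dfrac1{d_{\hat A}}\text{ and }d_{\hat A}\le d^2,\\[2mm] \dfrac{(1-\frac1{d^2})(1-F)}{1-\frac1{d_{\hat A}}}&\text{if }F>\dfrac1{d_{\hat A}}\text{ and }d_{\hat A}>d^2.\end{cases}$$ Moreover, if $F\le\frac1{d_{\hat A}}$, or if $F>\frac1{d_{\hat A}}$ and $d_{\hat A}\le d^2$, then $$e_{\mathrm{PPT}}\big(\mathcal S^d_{AB},\rho^{(F,d_{\hat A})}_{\hat A\hat B}\big)=e_{\mathrm{LOCC}}\big(\mathcal S^d_{AB},\rho^{(F,d_{\hat A})}_{\hat A\hat B}\big).$$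 -/

import Mathlib

open scoped Matrix Kronecker ComplexOrder

noncomputable section

namespace Teleport

/-- Operators on the finite-dimensional Hilbert space `ℂ^a` with a fixed orthonormal basis
indexed by `a`. The index type of a composite system is the product of the index types. -/
abbrev Op (a : Type) := Matrix a a ℂ

/-- Linear maps taking operators of system `a` to operators of system `b`. -/
abbrev SuperOp (a b : Type) := Op a →ₗ[ℂ] Op b

/-- A quantum state (density operator). -/
def IsState {a : Type} [Fintype a] (ρ : Op a) : Prop :=
  ρ.PosSemidef ∧ ρ.trace = 1

/-- The tensor product `E ⊗ G` of two linear maps on operators: the linear map with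
`X ⊗ Y ↦ E X ⊗ G Y`, written out on the matrix units `|i⟩⟨i'| ⊗ |j⟩⟨j'|`. -/
def tensorMap {a b a' b' : Type} [Fintype a] [DecidableEq a] [Fintype b] [DecidableEq b]
    (E : SuperOp a a') (G : SuperOp b b') : SuperOp (a × b) (a' × b') where
  toFun X := ∑ i : a, ∑ i' : a, ∑ j : b, ∑ j' : b,
    X (i, j) (i', j') • (E (Matrix.single i i' 1) ⊗ₖ G (Matrix.single j j' 1))
  map_add' X Y := by
    simp only [Matrix.add_apply, add_smul, Finset.sum_add_distrib]
  map_smul' c X := by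
    simp only [Matrix.smul_apply, smul_assoc, Finset.smul_sum, RingHom.id_apply]

/-- Complete positivity: `id_R ⊗ N` preserves positive semi-definiteness for every
finite-dimensional reference system `R`. -/
def IsCP {a b : Type} [Fintype a] [DecidableEq a] (N : SuperOp a b) : Prop :=
  ∀ (r : ℕ) (X : Op (Fin r × a)), X.PosSemidef →
    (tensorMap (LinearMap.id : SuperOp (Fin r) (Fin r)) N X).PosSemidef

/-- Trace preservation. -/
def IsTP {a b : Type} [Fintype a] [Fintype b] (N : SuperOp a b) : Prop :=
  ∀ X : Op a, (N X).trace = X.trace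

/-- Quantum channels: completely positive and trace-preserving maps. -/
def IsChannel {a b : Type} [Fintype a] [DecidableEq a] [Fintype b] (N : SuperOp a b) : Prop :=
  IsCP N ∧ IsTP N

/-- Quantum instruments with outcomes in `Fin n`: completely positive maps whose sum is trace
preserving. -/
def IsInstrument {a b : Type} [Fintype a] [DecidableEq a] [Fintype b] {n : ℕ}
    (E : Fin n → SuperOp a b) : Prop :=
  (∀ x, IsCP (E x)) ∧ IsTP (∑ x, E x)

/-- Bipartite channels implementable by local operations and classical communication, Alice
holding the first tensor factor and Bob the second. A protocol either ends with local channels on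
both sides, or starts with one party applying a quantum instrument to her or his system (which may
change its dimension) and announcing the outcome `x`, after which the parties go on with an LOCC
protocol `L x` that may depend on `x`. The number of rounds is finite and arbitrary. -/
inductive IsLOCC {a' b' : Type} [Fintype a'] [Fintype b'] :
    ∀ {a b : Type} [Fintype a] [DecidableEq a] [Fintype b] [DecidableEq b],
      SuperOp (a × b) (a' × b') → Prop
  | localOps {a b : Type} [Fintype a] [DecidableEq a] [Fintype b] [DecidableEq b]
      (E : SuperOp a a') (G : SuperOp b b') (hE : IsChannel E) (hG : IsChannel G) :
      IsLOCC (tensorMap E G)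
  | alice {a b c : Type} [Fintype a] [DecidableEq a] [Fintype b] [DecidableEq b]
      [Fintype c] [DecidableEq c] {n : ℕ}
      (E : Fin n → SuperOp a c) (L : Fin n → SuperOp (c × b) (a' × b'))
      (hE : IsInstrument E) (hL : ∀ x, IsLOCC (L x)) :
      IsLOCC (∑ x, L x ∘ₗ tensorMap (E x) (LinearMap.id : SuperOp b b))
  | bob {a b c : Type} [Fintype a] [DecidableEq a] [Fintype b] [DecidableEq b]
      [Fintype c] [DecidableEq c] {n : ℕ}
      (G : Fin n → SuperOp b c) (L : Fin n → SuperOp (a × c) (a' × b'))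
      (hG : IsInstrument G) (hL : ∀ x, IsLOCC (L x)) :
      IsLOCC (∑ x, L x ∘ₗ tensorMap (LinearMap.id : SuperOp a a) (G x))

/-- The partial transpose on Bob's system. -/
def partialTranspose (a b : Type) : SuperOp (a × b) (a × b) where
  toFun X := Matrix.of fun p q => X (p.1, q.2) (q.1, p.2)
  map_add' _ _ := rfl
  map_smul' _ _ := rfl

/-- Completely PPT-preserving (C-PPT-P) bipartite channels. -/
def IsCPPTP {a b a' b' : Type} [Fintype a] [DecidableEq a] [Fintype b] [DecidableEq b]
    [Fintype a'] [Fintype b'] (P : SuperOp (a × b) (a' × b')) : Prop :=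
  IsChannel P ∧ IsCP (partialTranspose a' b' ∘ₗ P ∘ₗ partialTranspose a b)

/-- The trace norm `‖X‖₁ = Tr √(X† X)`. -/
def traceNorm {a : Type} [Fintype a] [DecidableEq a] (X : Op a) : ℝ :=
  (cfc Real.sqrt (Xᴴ * X)).trace.re

/-- The diamond distance `‖N - M‖_⋄`: the supremum of `‖(id_R ⊗ N)(ρ) - (id_R ⊗ M)(ρ)‖₁` over all
finite-dimensional reference systems `R` and all states `ρ` of `R` and the input system. -/
def diamondDist {a b : Type} [Fintype a] [DecidableEq a] [Fintype b] [DecidableEq b]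
    (N M : SuperOp a b) : ℝ :=
  sSup {t : ℝ | ∃ (r : ℕ) (ρ : Op (Fin r × a)), IsState ρ ∧
    t = traceNorm (tensorMap (LinearMap.id : SuperOp (Fin r) (Fin r)) N ρ -
      tensorMap (LinearMap.id : SuperOp (Fin r) (Fin r)) M ρ)}

/-- Appending the resource state: `ω_{AB} ↦ ω_{AB} ⊗ ρ_{ÂB̂}`, with the systems reordered so that
Alice holds `AÂ` and Bob holds `BB̂`. -/
def attach {a b r s : Type} (ρ : Op (r × s)) : SuperOp (a × b) ((a × r) × (b × s)) where
  toFun ω := (ω ⊗ₖ ρ).submatrix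
    (Equiv.prodProdProdComm a r b s) (Equiv.prodProdProdComm a r b s)
  map_add' ω τ := by
    rw [Matrix.add_kronecker]; rfl
  map_smul' c ω := by
    rw [Matrix.smul_kronecker]; rfl

/-- The simulation `ω_{AB} ↦ P(ω_{AB} ⊗ ρ_{ÂB̂})` obtained from the bipartite channel `P` and the
resource state `ρ`. -/
def simulation {a b r s a' b' : Type} (P : SuperOp ((a × r) × (b × s)) (a' × b'))
    (ρ : Op (r × s)) : SuperOp (a × b) (a' × b') :=
  P ∘ₗ attach ρ

section Errors

variable {a b r s a' b' : Type} [Fintype a] [DecidableEq a] [Fintype b] [DecidableEq b]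
  [Fintype r] [DecidableEq r] [Fintype s] [DecidableEq s]
  [Fintype a'] [DecidableEq a'] [Fintype b'] [DecidableEq b']

/-- The simulation error of the bipartite channel `N` with resource state `ρ`, in normalized
diamond distance, minimized over all LOCC channels. -/
def errLOCC (N : SuperOp (a × b) (a' × b')) (ρ : Op (r × s)) : ℝ :=
  sInf {e : ℝ | ∃ L : SuperOp ((a × r) × (b × s)) (a' × b'),
    IsLOCC L ∧ e = 1 / 2 * diamondDist N (simulation L ρ)}

/-- The simulation error of the bipartite channel `N` with resource state `ρ`, in normalized
diamond distance, minimized over all C-PPT-P channels. -/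
def errPPT (N : SuperOp (a × b) (a' × b')) (ρ : Op (r × s)) : ℝ :=
  sInf {e : ℝ | ∃ P : SuperOp ((a × r) × (b × s)) (a' × b'),
    IsCPPTP P ∧ e = 1 / 2 * diamondDist N (simulation P ρ)}

end Errors

/-- The unitary swap operator `∑_{i,j} |i⟩⟨j| ⊗ |j⟩⟨i|` on two `d`-dimensional systems. -/
def swapOp (d : ℕ) : Op (Fin d × Fin d) :=
  ∑ i : Fin d, ∑ j : Fin d, (Matrix.single i j 1 : Op (Fin d)) ⊗ₖ (Matrix.single j i 1 : Op (Fin d))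

/-- The unitary swap channel `ω ↦ S ω S†`. -/
def swapChannel (d : ℕ) : SuperOp (Fin d × Fin d) (Fin d × Fin d) where
  toFun ω := swapOp d * ω * (swapOp d)ᴴ
  map_add' ω τ := by rw [mul_add, add_mul]
  map_smul' c ω := by rw [mul_smul_comm, smul_mul_assoc, RingHom.id_apply]

/-- The maximally entangled state `(1/d) ∑_{i,j} |i⟩⟨j| ⊗ |i⟩⟨j|`. -/
def maxEntangled (d : ℕ) : Op (Fin d × Fin d) :=
  (1 / (d : ℂ)) • ∑ i : Fin d, ∑ j : Fin d,
    (Matrix.single i j 1 : Op (Fin d)) ⊗ₖ (Matrix.single i j 1 : Op (Fin d))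

/-- The isotropic state `F Φ + (1 - F) (I - Φ) / (D² - 1)` of fidelity `F` and dimension `D`. -/
def isotropicState (D : ℕ) (F : ℝ) : Op (Fin D × Fin D) :=
  (F : ℂ) • maxEntangled D + ((1 - F : ℂ) / ((D : ℂ) ^ 2 - 1)) • (1 - maxEntangled D)

end Teleport

end

/-! Both bounds pass through one number, the entanglement fidelity `swapFidelity` of the simulated
map with the swap. Testing on a maximally entangled input shows that the error is at least one minus
the fidelity (`le_diamondDist_swapChannel`). Conversely, a simulation of the form p · swap + (CP
remainder) has error at most 1 - p (`diamondDist_le_of_eq_smul_add`). Hence the error equals 1 - p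
as soon as p bounds the fidelity of every C-PPT-P simulation and some admissible simulation contains
the swap with weight p (`errPPT_eq`, `errLOCC_eq`).

Bounding the fidelity: it is linear in the resource, so on an isotropic state it depends only on its
values t at the identity and v at Φ, where 0 ≤ v ≤ 1. The PPT condition bounds its value at the
partial transpose of any σ ≥ 0 by Tr σ / d² (`abs_simulationFidelity_le`). Taking σ = 1 ± S, with S
the swap operator of the resource, whose partial transposes are 1 ± DΦ, gives |t ± Dv| ≤ (D² ± D) /
d². What remains is a linear program in (t, v), solved by explicit multipliers; the sign of F - 1/D
and the constraint v ≤ 1 produce the three regimes.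

Attaining the bound: LOCC channels are C-PPT-P (`IsLOCC.isCPPTP`), so in the first two regimes one
LOCC protocol settles both errors. Bidirectional teleportation with d⁴ outcomes has Kraus operators
whose sum is a multiple of the swap, and comparing them with their mean (`isCP_kraus_sub`) shows
that the swap is contained with weight |∑ ψ(p,p)|² / d². A product resource gives 1/d²; an embedded
Φ, available when D ≤ d², gives D/d². When D > d², `testAndSwap` tests the resource for Φ, swaps on
success, and on failure mixes swap and depolarization so that one PPT constraint is tight. -/

noncomputable section

namespace Teleport

set_option linter.unusedSectionVars false

/-! ### Kraus representations and tensor products of maps -/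

section Kraus

variable {a b c a' b' : Type} [Fintype a] [DecidableEq a] [Fintype b] [DecidableEq b]
  [Fintype c] [DecidableEq c]

/-- The linear map `X ↦ ∑ k, K k * X * (K k)ᴴ`. -/
def kraus {κ a b : Type} [Fintype κ] [Fintype a] (K : κ → Matrix b a ℂ) : SuperOp a b where
  toFun X := ∑ k, K k * X * (K k)ᴴ
  map_add' X Y := by simp only [Matrix.mul_add, Matrix.add_mul,
    Finset.sum_add_distrib]
  map_smul' c X := by simp only [Matrix.mul_smul, Matrix.smul_mul, Finset.smul_sum,
    RingHom.id_apply]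

theorem kraus_apply {κ a b : Type} [Fintype κ] [Fintype a] (K : κ → Matrix b a ℂ) (X : Op a) :
    kraus K X = ∑ k, K k * X * (K k)ᴴ := rfl

theorem superOp_ext {M N : SuperOp a b'}
    (h : ∀ i j, M (Matrix.single i j 1) = N (Matrix.single i j 1)) : M = N := by
  apply Matrix.ext_linearMap
  intro i j
  ext1
  simpa using h i j

theorem sum_single_smul {β : Type*} [AddCommMonoid β] [Module ℂ β] (i j : a) (f : a → a → β) :
    ∑ x, ∑ y, (Matrix.single i j (1 : ℂ)) x y • f x y = f i j := by
  rw [Finset.sum_eq_single i, Finset.sum_eq_single j]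
  · simp
  · intro y _ hy; simp [hy.symm]
  · simp
  · intro x _ hx; simp [hx.symm]
  · simp

theorem superOp_apply (N : SuperOp a b') (X : Op a) :
    N X = ∑ i, ∑ j, X i j • N (Matrix.single i j 1) := by
  conv_lhs => rw [Matrix.matrix_eq_sum_single X]
  simp only [map_sum]
  refine Finset.sum_congr rfl fun i _ => Finset.sum_congr rfl fun j _ => ?_
  rw [← map_smul, Matrix.smul_single, smul_eq_mul, mul_one]

theorem tensorMap_single (E : SuperOp a a') (G : SuperOp b b') (i i' : a) (j j' : b) :
    tensorMap E G (Matrix.single (i, j) (i', j') 1) =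
      E (Matrix.single i i' 1) ⊗ₖ G (Matrix.single j j' 1) := by
  have h : ∀ x x' y y', (Matrix.single (i, j) (i', j') (1 : ℂ)) (x, y) (x', y') =
      Matrix.single i i' (1 : ℂ) x x' * Matrix.single j j' (1 : ℂ) y y' := by
    intro x x' y y'
    rw [← mul_one (1 : ℂ), ← Matrix.single_kronecker_single]
    simp [Matrix.kroneckerMap_apply]
  simp only [tensorMap, LinearMap.coe_mk, AddHom.coe_mk, h, mul_smul, ← Finset.smul_sum]
  rw [sum_single_smul i i' (fun x x' => ∑ y, ∑ y', Matrix.single j j' (1 : ℂ) y y' •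
    (E (Matrix.single x x' 1) ⊗ₖ G (Matrix.single y y' 1)))]
  rw [sum_single_smul j j' (fun y y' =>
    (E (Matrix.single i i' 1) ⊗ₖ G (Matrix.single y y' 1)))]

/-- The map acts on each block over the reference system separately, which is how Choi matrices are
read below. -/
theorem tensorMap_id_apply (N : SuperOp b b') (X : Op (a × b)) (p p' : a) (k l : b') :
    tensorMap (LinearMap.id : SuperOp a a) N X (p, k) (p', l) =
      N (Matrix.of fun i j => X (p, i) (p', j)) k l := by
  rw [superOp_apply N]
  simp only [tensorMap, LinearMap.coe_mk, AddHom.coe_mk, Matrix.sum_apply, Matrix.smul_apply,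
    Matrix.kroneckerMap_apply, smul_eq_mul, LinearMap.id_apply, Matrix.of_apply]
  rw [Finset.sum_eq_single p, Finset.sum_eq_single p']
  · simp
  · intro y _ hy; simp [hy]
  · simp
  · intro x _ hx; simp [hx]
  · simp

theorem tensorMap_kraus {κ ι : Type} [Fintype κ] [Fintype ι] (K : κ → Matrix a' a ℂ)
    (L : ι → Matrix b' b ℂ) :
    tensorMap (kraus K) (kraus L) = kraus (fun x : κ × ι => K x.1 ⊗ₖ L x.2) := by
  apply superOp_ext
  rintro ⟨i, j⟩ ⟨i', j'⟩
  rw [tensorMap_single, ← mul_one (1 : ℂ), ← Matrix.single_kronecker_single]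
  simp only [mul_one, kraus_apply, Fintype.sum_prod_type, Matrix.conjTranspose_kronecker,
    ← Matrix.mul_kronecker_mul]
  ext ⟨k, l⟩ ⟨k', l'⟩
  simp only [Matrix.sum_apply, Matrix.kroneckerMap_apply, Finset.sum_mul, Finset.mul_sum]
  rw [Finset.sum_comm]

theorem kraus_one : kraus (fun _ : Unit => (1 : Matrix a a ℂ)) = LinearMap.id := by
  ext1 X; simp [kraus_apply]

theorem posSemidef_kraus {κ : Type} [Fintype κ] [Fintype b'] (K : κ → Matrix b' a ℂ) {X : Op a}
    (hX : X.PosSemidef) : (kraus K X).PosSemidef :=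
  Matrix.posSemidef_sum _ fun k _ => hX.mul_mul_conjTranspose_same (K k)

theorem isCP_kraus {κ : Type} [Fintype κ] [Fintype b'] (K : κ → Matrix b' a ℂ) : IsCP (kraus K) := by
  intro r X hX
  rw [← kraus_one, tensorMap_kraus]
  exact posSemidef_kraus _ hX

open scoped MatrixOrder in
theorem exists_eq_conjTranspose_mul_self {X : Op a} (hX : X.PosSemidef) :
    ∃ B : Op a, X = Bᴴ * B :=
  CStarAlgebra.nonneg_iff_eq_star_mul_self.mp hX.nonneg

/-- Choi's argument: the image of the unnormalized maximally entangled operator is positive, hence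
of the form `Bᴴ * B`, and the conjugated rows of `B`, reshaped into matrices, are Kraus operators.
-/
theorem IsCP.exists_kraus {N : SuperOp a b} (hN : IsCP N) :
    ∃ K : a × b → Matrix b a ℂ, N = kraus K := by
  let e := Fintype.equivFin a
  let v : Fin (Fintype.card a) × a → ℂ := fun p => if e.symm p.1 = p.2 then 1 else 0
  have h := hN _ _ (Matrix.posSemidef_vecMulVec_self_star v)
  have h2 := h.submatrix (fun p : a × b => (e p.1, p.2))
  obtain ⟨B, hB⟩ := exists_eq_conjTranspose_mul_self h2
  refine ⟨fun m => Matrix.of fun k i => star (B m (i, k)), superOp_ext fun i j => ?_⟩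
  ext k l
  have h3 := congrFun (congrFun hB (i, k)) (j, l)
  rw [Matrix.submatrix_apply, tensorMap_id_apply] at h3
  have h4 : (Matrix.of fun i' j' => Matrix.vecMulVec v (star v) (e i, i') (e j, j')) =
      Matrix.single i j (1 : ℂ) := by
    ext i' j'
    by_cases h5 : i = i' <;> by_cases h6 : j = j' <;>
      simp [Matrix.vecMulVec_apply, v, h5, h6]
  simp only [h4] at h3
  rw [h3, kraus_apply, Matrix.sum_apply, Matrix.mul_apply]
  refine Finset.sum_congr rfl fun m _ => ?_
  simp [Matrix.mul_apply, Matrix.single_apply, ite_and]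

theorem kraus_comp_kraus {κ ι : Type} [Fintype κ] [Fintype ι] (K : κ → Matrix a' b ℂ)
    (L : ι → Matrix b a ℂ) :
    kraus K ∘ₗ kraus L = kraus (fun x : κ × ι => K x.1 * L x.2) := by
  ext1 X
  simp only [LinearMap.comp_apply, kraus_apply, Fintype.sum_prod_type, Matrix.mul_sum,
    Matrix.sum_mul, Matrix.conjTranspose_mul, Matrix.mul_assoc]

theorem IsCP.comp {N : SuperOp b c} {M : SuperOp a b} (hN : IsCP N) (hM : IsCP M) :
    IsCP (N ∘ₗ M) := by
  obtain ⟨K, rfl⟩ := hN.exists_kraus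
  obtain ⟨L, rfl⟩ := hM.exists_kraus
  rw [kraus_comp_kraus]
  exact isCP_kraus _

theorem tensorMap_add_right (E : SuperOp a a') (G H : SuperOp b b') :
    tensorMap E (G + H) = tensorMap E G + tensorMap E H := by
  ext1 X
  simp only [tensorMap, LinearMap.coe_mk, AddHom.coe_mk, LinearMap.add_apply,
    Matrix.kronecker_add, smul_add, Finset.sum_add_distrib]

theorem tensorMap_smul_right (E : SuperOp a a') (G : SuperOp b b') (z : ℂ) :
    tensorMap E (z • G) = z • tensorMap E G := by
  ext1 X
  simp only [tensorMap, LinearMap.coe_mk, AddHom.coe_mk, LinearMap.smul_apply,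
    Matrix.kronecker_smul, Finset.smul_sum]
  refine Finset.sum_congr rfl fun i _ => Finset.sum_congr rfl fun i' _ =>
    Finset.sum_congr rfl fun j _ => Finset.sum_congr rfl fun j' _ => smul_comm _ _ _

theorem tensorMap_zero_right (E : SuperOp a a') :
    tensorMap E (0 : SuperOp b b') = 0 := by
  simpa using tensorMap_smul_right E (0 : SuperOp b b') 0

theorem tensorMap_sum_right {ι : Type*} (s : Finset ι) (E : SuperOp a a')
    (G : ι → SuperOp b b') :
    tensorMap E (∑ x ∈ s, G x) = ∑ x ∈ s, tensorMap E (G x) := by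
  classical
  induction s using Finset.induction_on with
  | empty => simp [tensorMap_zero_right]
  | insert x s hx ih => rw [Finset.sum_insert hx, Finset.sum_insert hx, tensorMap_add_right, ih]

theorem tensorMap_add_left (E H : SuperOp a a') (G : SuperOp b b') :
    tensorMap (E + H) G = tensorMap E G + tensorMap H G := by
  ext1 X
  simp only [tensorMap, LinearMap.coe_mk, AddHom.coe_mk, LinearMap.add_apply,
    Matrix.add_kronecker, smul_add, Finset.sum_add_distrib]

theorem tensorMap_zero_left (G : SuperOp b b') :
    tensorMap (0 : SuperOp a a') G = 0 := by
  ext1 X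
  simp [tensorMap]

theorem tensorMap_sum_left {ι : Type*} (s : Finset ι) (E : ι → SuperOp a a')
    (G : SuperOp b b') :
    tensorMap (∑ x ∈ s, E x) G = ∑ x ∈ s, tensorMap (E x) G := by
  classical
  induction s using Finset.induction_on with
  | empty => simp [tensorMap_zero_left]
  | insert x s hx ih => rw [Finset.sum_insert hx, Finset.sum_insert hx, tensorMap_add_left, ih]

theorem IsCP.add {N M : SuperOp a b'} (hN : IsCP N) (hM : IsCP M) : IsCP (N + M) := by
  intro r X hX
  rw [tensorMap_add_right]
  exact (hN r X hX).add (hM r X hX)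

theorem IsCP.sum {ι : Type*} (s : Finset ι) {N : ι → SuperOp a b'} (hN : ∀ x ∈ s, IsCP (N x)) :
    IsCP (∑ x ∈ s, N x) := by
  intro r X hX
  rw [tensorMap_sum_right, LinearMap.sum_apply]
  exact Matrix.posSemidef_sum _ fun x hx => hN x hx r X hX

theorem IsCP.smul {N : SuperOp a b'} (hN : IsCP N) {t : ℝ} (ht : 0 ≤ t) :
    IsCP ((t : ℂ) • N) := by
  intro r X hX
  rw [tensorMap_smul_right]
  exact (hN r X hX).smul (Complex.zero_le_real.mpr ht)

theorem IsCP.id : IsCP (LinearMap.id : SuperOp a a) := by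
  rw [← kraus_one]; exact isCP_kraus _

theorem IsCP.tensor {a' b' : Type} [Fintype a'] [DecidableEq a'] [Fintype b'] [DecidableEq b']
    {E : SuperOp a a'} {G : SuperOp b b'} (hE : IsCP E) (hG : IsCP G) :
    IsCP (tensorMap E G) := by
  obtain ⟨K, rfl⟩ := hE.exists_kraus
  obtain ⟨L, rfl⟩ := hG.exists_kraus
  rw [tensorMap_kraus]
  exact isCP_kraus _

theorem IsTP.tensor [Fintype a'] [Fintype b']
    {E : SuperOp a a'} {G : SuperOp b b'} (hE : IsTP E) (hG : IsTP G) :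
    IsTP (tensorMap E G) := by
  intro X
  rw [superOp_apply (tensorMap E G) X, Matrix.matrix_eq_sum_single X]
  simp only [Matrix.trace_sum, Matrix.trace_smul]
  rw [← Matrix.matrix_eq_sum_single X]
  refine Finset.sum_congr rfl fun i _ => Finset.sum_congr rfl fun j _ => ?_
  rw [tensorMap_single, Matrix.trace_kronecker, hE, hG]
  obtain ⟨i, i'⟩ := i
  obtain ⟨j, j'⟩ := j
  rw [← Matrix.trace_kronecker, Matrix.single_kronecker_single, mul_one, ← Matrix.trace_smul,
    Matrix.smul_single, smul_eq_mul, mul_one]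

theorem IsTP.id : IsTP (LinearMap.id : SuperOp a a) := fun _ => rfl

theorem isTP_kraus {κ : Type} [Fintype κ] [Fintype b'] {K : κ → Matrix b' a ℂ}
    (h : ∑ k, (K k)ᴴ * K k = 1) : IsTP (kraus K) := by
  intro X
  simp only [kraus_apply, Matrix.trace_sum]
  calc ∑ k, (K k * X * (K k)ᴴ).trace = ∑ k, ((K k)ᴴ * K k * X).trace :=
        Finset.sum_congr rfl fun k _ => by rw [Matrix.trace_mul_comm, Matrix.mul_assoc]
    _ = X.trace := by rw [← Matrix.trace_sum, ← Matrix.sum_mul, h, one_mul]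

end Kraus

/-! ### Partial transposition, and LOCC channels are C-PPT-P -/

section PartialTranspose

variable {a b c a' b' : Type} [Fintype a] [DecidableEq a] [Fintype b] [DecidableEq b]
  [Fintype c] [DecidableEq c] [Fintype a'] [Fintype b']

theorem partialTranspose_apply (a b : Type) (X : Op (a × b)) (p q : a × b) :
    partialTranspose a b X p q = X (p.1, q.2) (q.1, p.2) := rfl

theorem partialTranspose_comp_self (a b : Type) :
    partialTranspose a b ∘ₗ partialTranspose a b = LinearMap.id := by
  ext1 X
  ext p q
  simp [partialTranspose_apply]

theorem partialTranspose_single (i i' : a) (j j' : b) :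
    partialTranspose a b (Matrix.single (i, j) (i', j') 1) =
      Matrix.single (i, j') (i', j) 1 := by
  ext ⟨x, y⟩ ⟨x', y'⟩
  simp only [partialTranspose_apply, Matrix.single_apply, Prod.mk.injEq]
  congr 1
  simp only [eq_iff_iff]
  tauto

/-- The conjugation of a map on operators by the transpose. -/
def transposeConj {b b' : Type} (G : SuperOp b b') : SuperOp b b' where
  toFun X := (G Xᵀ)ᵀ
  map_add' X Y := by simp
  map_smul' z X := by simp

theorem partialTranspose_tensorMap (E : SuperOp a a') (G : SuperOp b b') :
    partialTranspose a' b' ∘ₗ tensorMap E G ∘ₗ partialTranspose a b =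
      tensorMap E (transposeConj G) := by
  apply superOp_ext
  rintro ⟨i, j⟩ ⟨i', j'⟩
  rw [LinearMap.comp_apply, LinearMap.comp_apply, partialTranspose_single, tensorMap_single,
    tensorMap_single]
  ext ⟨k, l⟩ ⟨k', l'⟩
  simp [partialTranspose_apply, transposeConj, Matrix.kroneckerMap_apply]

/-- Conjugating a map by the transpose replaces its Kraus operators by their entrywise complex
conjugates. -/
theorem IsCP.transposeConj [DecidableEq b'] {G : SuperOp b b'} (hG : IsCP G) :
    IsCP (transposeConj G) := by
  obtain ⟨K, rfl⟩ := hG.exists_kraus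
  have : Teleport.transposeConj (kraus K) = kraus (fun k => (K k).map star) := by
    ext1 X
    simp only [Teleport.transposeConj, LinearMap.coe_mk, AddHom.coe_mk, kraus_apply,
      Matrix.transpose_sum, Matrix.transpose_mul, Matrix.transpose_transpose]
    refine Finset.sum_congr rfl fun k _ => ?_
    rw [← Matrix.mul_assoc]
    congr 2
    ext i j
    simp
  rw [this]
  exact isCP_kraus _

theorem IsCPPTP.tensor [DecidableEq a'] [DecidableEq b'] {E : SuperOp a a'} {G : SuperOp b b'}
    (hE : IsChannel E) (hG : IsChannel G) : IsCPPTP (tensorMap E G) := by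
  refine ⟨⟨hE.1.tensor hG.1, hE.2.tensor hG.2⟩, ?_⟩
  rw [partialTranspose_tensorMap]
  exact hE.1.tensor hG.1.transposeConj

/-- The partial transpose is an involution, so two copies may be inserted at the intermediate
system. -/
theorem partialTranspose_comp_comp {a b a' b' c d : Type} (L : SuperOp (c × d) (a' × b'))
    (M : SuperOp (a × b) (c × d)) :
    partialTranspose a' b' ∘ₗ (L ∘ₗ M) ∘ₗ partialTranspose a b =
      (partialTranspose a' b' ∘ₗ L ∘ₗ partialTranspose c d) ∘ₗ
        (partialTranspose c d ∘ₗ M ∘ₗ partialTranspose a b) := by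
  have h : ∀ X, partialTranspose c d (partialTranspose c d X) = X := fun X =>
    DFunLike.congr_fun (partialTranspose_comp_self c d) X
  ext1 X
  simp only [LinearMap.comp_apply, h]

/-- One round of an LOCC protocol preserves `IsCPPTP`. -/
theorem isCPPTP_sum_comp {d : Type} [Fintype d] [DecidableEq d] [DecidableEq a'] [DecidableEq b']
    {n : ℕ}
    (L : Fin n → SuperOp (c × d) (a' × b')) (M : Fin n → SuperOp (a × b) (c × d))
    (hL : ∀ x, IsCPPTP (L x)) (hM : ∀ x, IsCP (M x))
    (hM' : ∀ x, IsCP (partialTranspose c d ∘ₗ M x ∘ₗ partialTranspose a b))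
    (hT : IsTP (∑ x, M x)) : IsCPPTP (∑ x, L x ∘ₗ M x) := by
  refine ⟨⟨IsCP.sum _ fun x _ => (hL x).1.1.comp (hM x), fun X => ?_⟩, ?_⟩
  · rw [← hT X, LinearMap.sum_apply, LinearMap.sum_apply, Matrix.trace_sum, Matrix.trace_sum]
    exact Finset.sum_congr rfl fun x _ => (hL x).1.2 _
  · have : partialTranspose a' b' ∘ₗ (∑ x, L x ∘ₗ M x) ∘ₗ partialTranspose a b =
        ∑ x, partialTranspose a' b' ∘ₗ (L x ∘ₗ M x) ∘ₗ partialTranspose a b := by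
      ext1 X
      simp [LinearMap.sum_apply]
    rw [this]
    refine IsCP.sum _ fun x _ => ?_
    rw [partialTranspose_comp_comp]
    exact (hL x).2.comp (hM' x)

theorem IsLOCC.isCPPTP [DecidableEq a'] [DecidableEq b'] {L : SuperOp (a × b) (a' × b')}
    (h : IsLOCC L) : IsCPPTP L := by
  induction h with
  | localOps E G hE hG => exact IsCPPTP.tensor hE hG
  | alice E L hE _ ih =>
    refine isCPPTP_sum_comp _ _ ih (fun x => (hE.1 x).tensor IsCP.id) (fun x => ?_) ?_
    · rw [partialTranspose_tensorMap]
      exact (hE.1 x).tensor IsCP.id.transposeConj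
    · rw [← tensorMap_sum_left]
      exact hE.2.tensor IsTP.id
  | bob G L hG _ ih =>
    refine isCPPTP_sum_comp _ _ ih (fun x => IsCP.id.tensor (hG.1 x)) (fun x => ?_) ?_
    · rw [partialTranspose_tensorMap]
      exact IsCP.id.tensor (hG.1 x).transposeConj
    · rw [← tensorMap_sum_right]
      exact IsTP.id.tensor hG.2

end PartialTranspose

/-! ### Bounds on the trace norm of Hermitian operators -/

section TraceNorm

variable {a b : Type} [Fintype a] [DecidableEq a] [Fintype b] [DecidableEq b]

theorem exists_diagonalization_traceNorm {X : Op a} (hX : X.IsHermitian) :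
    ∃ (U : Op a) (l : a → ℝ), Uᴴ * U = 1 ∧ U * Uᴴ = 1 ∧
      Uᴴ * X * U = Matrix.diagonal (fun i => (l i : ℂ)) ∧ traceNorm X = ∑ i, |l i| := by
  have hU1 : (hX.eigenvectorUnitary : Op a)ᴴ * hX.eigenvectorUnitary = 1 :=
    Unitary.coe_star_mul_self hX.eigenvectorUnitary
  have hU2 : (hX.eigenvectorUnitary : Op a) * (hX.eigenvectorUnitary : Op a)ᴴ = 1 :=
    Unitary.coe_mul_star_self hX.eigenvectorUnitary
  refine ⟨hX.eigenvectorUnitary, hX.eigenvalues, hU1, hU2, ?_, ?_⟩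
  · have hs := hX.spectral_theorem
    rw [Unitary.conjStarAlgAut_apply] at hs
    generalize (hX.eigenvectorUnitary : Op a) = V at hU1 hU2 hs
    generalize hX.eigenvalues = l at hs
    rw [hs]
    calc _ = (Vᴴ * V) * Matrix.diagonal _ * (Vᴴ * V) := by
          simp only [Matrix.mul_assoc]; rfl
      _ = _ := by rw [hU1, one_mul, mul_one]; rfl
  · have hsa : IsSelfAdjoint X := hX
    have h1 : cfc Real.sqrt (Xᴴ * X) = cfc (fun x : ℝ => |x|) X := by
      rw [hX.eq, ← pow_two, ← cfc_comp_pow (R := ℝ) Real.sqrt 2 X]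
      simp only [Real.sqrt_sq_eq_abs]
    rw [traceNorm, h1, hX.cfc_eq, Matrix.IsHermitian.cfc, Unitary.conjStarAlgAut_apply,
      Matrix.trace_mul_comm, ← mul_assoc, Unitary.coe_star_mul_self, one_mul,
      Matrix.trace_diagonal, Complex.re_sum]
    simp

/-- In an eigenbasis of `A - B` each eigenvalue is a difference of nonnegative diagonal entries of
`A` and `B`, so no general triangle inequality is needed. -/
theorem traceNorm_sub_le {A B : Op a} (hA : A.PosSemidef) (hB : B.PosSemidef) :
    traceNorm (A - B) ≤ A.trace.re + B.trace.re := by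
  obtain ⟨U, l, -, hU, hd, ht⟩ := exists_diagonalization_traceNorm (hA.1.sub hB.1)
  have htr : ∀ C : Op a, (Uᴴ * C * U).trace = C.trace := fun C => by
    rw [Matrix.trace_mul_comm, ← Matrix.mul_assoc, hU, one_mul]
  rw [ht, ← htr A, ← htr B, Matrix.trace, Matrix.trace, Complex.re_sum, Complex.re_sum,
    ← Finset.sum_add_distrib]
  refine Finset.sum_le_sum fun i _ => ?_
  have h1 := (Complex.nonneg_iff.1 ((hA.conjTranspose_mul_mul_same U).diag_nonneg (i := i))).1
  have h2 := (Complex.nonneg_iff.1 ((hB.conjTranspose_mul_mul_same U).diag_nonneg (i := i))).1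
  have h3 := congrArg Complex.re (congrFun (congrFun hd i) i)
  rw [Matrix.mul_sub, Matrix.sub_mul] at h3
  simp only [Matrix.sub_apply, Complex.sub_re, Matrix.diagonal_apply_eq, Complex.ofReal_re,
    Matrix.diag_apply] at *
  rw [← h3, abs_le]
  constructor <;> linarith

/-- Duality with the contraction 2|v⟩⟨v| - 1: in an eigenbasis of `X` its diagonal entries 2|wᵢ|² -
1 lie in [-1, 1]. -/
theorem le_traceNorm {X : Op a} (hX : X.IsHermitian) (v : a → ℂ) (hv : star v ⬝ᵥ v = 1) :
    2 * (star v ⬝ᵥ X *ᵥ v).re - X.trace.re ≤ traceNorm X := by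
  obtain ⟨U, l, hU', hU, hd, ht⟩ := exists_diagonalization_traceNorm hX
  have hX' : X = U * Matrix.diagonal (fun i => (l i : ℂ)) * Uᴴ := by
    rw [← hd]
    calc X = (U * Uᴴ) * X * (U * Uᴴ) := by rw [hU, one_mul, mul_one]
      _ = _ := by simp only [Matrix.mul_assoc]
  have htr : X.trace.re = ∑ i, l i := by
    rw [hX', Matrix.trace_mul_comm, ← Matrix.mul_assoc, hU', one_mul, Matrix.trace_diagonal,
      Complex.re_sum]
    simp
  set w := Uᴴ *ᵥ v with hw
  have hsw : star w = star v ᵥ* U := by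
    rw [hw, Matrix.star_mulVec, Matrix.conjTranspose_conjTranspose]
  have h1 : ∑ i, ‖w i‖ ^ 2 = 1 := by
    have : star w ⬝ᵥ w = 1 := by
      rw [hsw, hw, ← Matrix.dotProduct_mulVec, Matrix.mulVec_mulVec, hU, Matrix.one_mulVec, hv]
    have h := congrArg Complex.re this
    rw [dotProduct, Complex.re_sum, Complex.one_re] at h
    rw [← h]
    refine Finset.sum_congr rfl fun i _ => ?_
    rw [Pi.star_apply, RCLike.star_def, Complex.conj_mul']
    norm_cast
  have h2 : (star v ⬝ᵥ X *ᵥ v).re = ∑ i, l i * ‖w i‖ ^ 2 := by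
    have : star v ⬝ᵥ X *ᵥ v = star w ⬝ᵥ (Matrix.diagonal (fun i => (l i : ℂ)) *ᵥ w) := by
      rw [hsw, hw, ← Matrix.dotProduct_mulVec, Matrix.mulVec_mulVec, Matrix.mulVec_mulVec,
        ← hX']
    rw [this, dotProduct, Complex.re_sum]
    refine Finset.sum_congr rfl fun i _ => ?_
    rw [Pi.star_apply, Matrix.mulVec_diagonal, mul_left_comm, RCLike.star_def,
      Complex.conj_mul']
    norm_cast
  rw [ht, h2, htr, Finset.mul_sum, ← Finset.sum_sub_distrib]
  refine Finset.sum_le_sum fun i _ => ?_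
  have h3 : ‖w i‖ ^ 2 ≤ 1 := h1 ▸ Finset.single_le_sum (f := fun i => ‖w i‖ ^ 2)
    (fun j _ => sq_nonneg _) (Finset.mem_univ i)
  have h4 := sq_nonneg ‖w i‖
  calc 2 * (l i * ‖w i‖ ^ 2) - l i = l i * (2 * ‖w i‖ ^ 2 - 1) := by ring
    _ ≤ |l i * (2 * ‖w i‖ ^ 2 - 1)| := le_abs_self _
    _ = |l i| * |2 * ‖w i‖ ^ 2 - 1| := abs_mul _ _
    _ ≤ |l i| * 1 := by
      gcongr
      rw [abs_le]
      constructor <;> linarith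
    _ = |l i| := mul_one _

end TraceNorm

/-! ### Diamond distance to the swap channel versus entanglement fidelity -/

section Diamond

variable {a b : Type} [Fintype a] [DecidableEq a] [Fintype b] [DecidableEq b]

theorem IsTP.trace_tensorMap_id {N : SuperOp a b} (hN : IsTP N) {r : ℕ} (X : Op (Fin r × a)) :
    (tensorMap (LinearMap.id : SuperOp (Fin r) (Fin r)) N X).trace = X.trace :=
  IsTP.tensor IsTP.id hN X

/-- A real `sSup` over an unbounded set is 0, so this is required before any single input state can
bound `diamondDist` from below. -/
theorem diamondDist_bddAbove {N M : SuperOp a b} (hN : IsChannel N) (hM : IsChannel M) :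
    BddAbove {t : ℝ | ∃ (r : ℕ) (ρ : Op (Fin r × a)), IsState ρ ∧
    t = traceNorm (tensorMap (LinearMap.id : SuperOp (Fin r) (Fin r)) N ρ -
      tensorMap (LinearMap.id : SuperOp (Fin r) (Fin r)) M ρ)} := by
  refine ⟨2, ?_⟩
  rintro t ⟨r, ρ, hρ, rfl⟩
  refine (traceNorm_sub_le (hN.1 r ρ hρ.1) (hM.1 r ρ hρ.1)).trans ?_
  rw [hN.2.trace_tensorMap_id, hM.2.trace_tensorMap_id, hρ.2]
  norm_num

/-- The difference is (1 - p)N - R, and on a state both positive terms have trace 1 - p. -/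
theorem diamondDist_le_of_eq_smul_add {N M R : SuperOp a b} (hN : IsChannel N) (hM : IsTP M)
    (hR : IsCP R) {p : ℝ} (hp : p ≤ 1) (h : M = (p : ℂ) • N + R) :
    diamondDist N M ≤ 2 * (1 - p) := by
  have hp' : 0 ≤ 1 - p := sub_nonneg.2 hp
  -- Nonnegativity of the bound covers an empty set of states, where `sSup` is 0.
  refine Real.sSup_le ?_ (by linarith)
  rintro t ⟨r, ρ, hρ, rfl⟩
  have hM' := hM.trace_tensorMap_id ρ
  rw [h, tensorMap_add_right, tensorMap_smul_right, LinearMap.add_apply, LinearMap.smul_apply,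
    Matrix.trace_add, Matrix.trace_smul, hN.2.trace_tensorMap_id, hρ.2] at hM'
  have h1 : tensorMap (LinearMap.id : SuperOp (Fin r) (Fin r)) N ρ -
      tensorMap (LinearMap.id : SuperOp (Fin r) (Fin r)) M ρ =
      ((1 - p : ℝ) : ℂ) • tensorMap (LinearMap.id : SuperOp (Fin r) (Fin r)) N ρ -
      tensorMap (LinearMap.id : SuperOp (Fin r) (Fin r)) R ρ := by
    rw [h, tensorMap_add_right, tensorMap_smul_right, LinearMap.add_apply, LinearMap.smul_apply]
    push_cast
    rw [sub_smul, one_smul, sub_sub]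
  rw [h1]
  refine (traceNorm_sub_le ((hN.1 r ρ hρ.1).smul (Complex.zero_le_real.mpr hp'))
    (hR r ρ hρ.1)).trans ?_
  have h2 : (tensorMap (LinearMap.id : SuperOp (Fin r) (Fin r)) R ρ).trace = 1 - p := by
    rw [← hM']; simp
  rw [h2, Matrix.trace_smul, hN.2.trace_tensorMap_id, hρ.2]
  simp
  linarith

/-- The matrix of the swap operator. -/
theorem swapOp_apply (d : ℕ) (p q : Fin d × Fin d) :
    swapOp d p q = if p = q.swap then 1 else 0 := by
  obtain ⟨x, y⟩ := p
  obtain ⟨x', y'⟩ := q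
  simp only [swapOp, Matrix.single_kronecker_single, Matrix.sum_apply, mul_one]
  rw [Finset.sum_eq_single x, Finset.sum_eq_single y]
  · simp only [Matrix.single_apply, Prod.mk.injEq, Prod.swap_prod_mk, true_and]
    congr 1
    simp only [eq_iff_iff]
    tauto
  · intro j _ hj; simp [hj]
  · simp
  · intro i _ hi; simp [hi]
  · simp

theorem swapChannel_apply (d : ℕ) (X : Op (Fin d × Fin d)) (p q : Fin d × Fin d) :
    swapChannel d X p q = X p.swap q.swap := by
  have h : ∀ p q : Fin d × Fin d, (p = q.swap) ↔ (q = p.swap) := fun p q =>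
    ⟨fun h => by rw [h, Prod.swap_swap], fun h => by rw [h, Prod.swap_swap]⟩
  simp only [swapChannel, LinearMap.coe_mk, AddHom.coe_mk, Matrix.mul_apply, swapOp_apply,
    Matrix.conjTranspose_apply, h]
  simp

theorem isChannel_swapChannel (d : ℕ) : IsChannel (swapChannel d) := by
  refine ⟨?_, fun X => ?_⟩
  · have : swapChannel d = kraus (fun _ : Unit => swapOp d) := by
      ext1 X
      simp [swapChannel, kraus_apply]
    rw [this]
    exact isCP_kraus _
  · simp only [Matrix.trace, Matrix.diag_apply, swapChannel_apply]
    exact (Equiv.prodComm (Fin d) (Fin d)).sum_comp (fun p => X p p)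

/-- The entanglement fidelity of a bipartite map with the swap channel. -/
def swapFidelity {d : ℕ} (N : SuperOp (Fin d × Fin d) (Fin d × Fin d)) : ℂ :=
  (1 / (d : ℂ) ^ 4) * ∑ z : Fin d × Fin d, ∑ z' : Fin d × Fin d,
    N (Matrix.single z z' 1) z.swap z'.swap

theorem swapFidelity_swapChannel {d : ℕ} (hd : 1 ≤ d) : swapFidelity (swapChannel d) = 1 := by
  have : (d : ℂ) ≠ 0 := by exact_mod_cast (by omega : d ≠ 0)
  simp only [swapFidelity, swapChannel_apply, Prod.swap_swap, Matrix.single_apply_same,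
    Finset.sum_const, Finset.card_univ, Fintype.card_prod, Fintype.card_fin, nsmul_eq_mul]
  push_cast
  field_simp

/-- The input `v` is maximally entangled between AB and a copy of AB, reindexed by `e` because
references are of the form `Fin r`. The vector `w` is its image under the swap, and ⟨w|·|w⟩ of the
output is `swapFidelity`; the four entries 1/d of `v` and `w` account for the factor 1/d⁴. -/
theorem le_diamondDist_swapChannel {d : ℕ} (hd : 1 ≤ d)
    {N : SuperOp (Fin d × Fin d) (Fin d × Fin d)} (hN : IsChannel N) :
    2 * (1 - (swapFidelity N).re) ≤ diamondDist (swapChannel d) N := by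
  have hd0 : (d : ℂ) ≠ 0 := by exact_mod_cast (by omega : d ≠ 0)
  let e := Fintype.equivFin (Fin d × Fin d)
  let v : Fin (Fintype.card (Fin d × Fin d)) × (Fin d × Fin d) → ℂ :=
    fun p => if p.1 = e p.2 then 1 / (d : ℂ) else 0
  let w : Fin (Fintype.card (Fin d × Fin d)) × (Fin d × Fin d) → ℂ :=
    fun p => if p.1 = e p.2.swap then 1 / (d : ℂ) else 0
  have hw : star w ⬝ᵥ w = 1 := by
    simp only [dotProduct, Fintype.sum_prod_type_right (α₂ := Fin d × Fin d), Pi.star_apply, w]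
    simp
    field_simp
  have hv : IsState (Matrix.vecMulVec v (star v)) := by
    refine ⟨Matrix.posSemidef_vecMulVec_self_star v, ?_⟩
    rw [Matrix.trace_vecMulVec]
    simp only [dotProduct, Fintype.sum_prod_type_right (α₂ := Fin d × Fin d), Pi.star_apply, v]
    simp
    field_simp
  have hblock : ∀ z z' : Fin d × Fin d,
      (Matrix.of fun i j => Matrix.vecMulVec v (star v) (e z, i) (e z', j)) =
        (1 / (d : ℂ) ^ 2) • Matrix.single z z' (1 : ℂ) := by
    intro z z'
    ext i j
    simp only [Matrix.of_apply, Matrix.vecMulVec_apply, v, Pi.star_apply, e.injective.eq_iff,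
      Matrix.smul_apply, Matrix.single_apply, ite_and]
    by_cases h1 : z = i <;> by_cases h2 : z' = j <;> simp [h1, h2]
    field_simp
  have key : ∀ M : SuperOp (Fin d × Fin d) (Fin d × Fin d),
      star w ⬝ᵥ (tensorMap (LinearMap.id : SuperOp (Fin _) (Fin _)) M
        (Matrix.vecMulVec v (star v))) *ᵥ w = swapFidelity M := by
    intro M
    simp only [dotProduct, Matrix.mulVec, Pi.star_apply,
      Fintype.sum_prod_type_right (α₂ := Fin d × Fin d), tensorMap_id_apply, w,
      apply_ite star, star_zero, ite_mul, mul_ite, zero_mul, mul_zero, Finset.sum_ite_eq',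
      Finset.mem_univ, if_true, hblock, map_smul, Matrix.smul_apply]
    rw [swapFidelity, Finset.mul_sum, ← (Equiv.prodComm (Fin d) (Fin d)).sum_comp]
    refine Finset.sum_congr rfl fun z _ => ?_
    rw [Finset.mul_sum, Finset.mul_sum, ← (Equiv.prodComm (Fin d) (Fin d)).sum_comp]
    refine Finset.sum_congr rfl fun z' _ => ?_
    simp
    field_simp
  have hX : (tensorMap (LinearMap.id : SuperOp (Fin _) (Fin _)) (swapChannel d)
      (Matrix.vecMulVec v (star v)) - tensorMap (LinearMap.id : SuperOp (Fin _) (Fin _)) N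
      (Matrix.vecMulVec v (star v))).IsHermitian :=
    ((isChannel_swapChannel d).1 _ _ hv.1).1.sub (hN.1 _ _ hv.1).1
  refine le_trans ?_ (le_csSup (diamondDist_bddAbove (isChannel_swapChannel d) hN)
    ⟨_, _, hv, rfl⟩)
  -- Both maps preserve the trace, so the trace term of `le_traceNorm` vanishes.
  refine le_trans (le_of_eq ?_) (le_traceNorm hX w hw)
  rw [Matrix.trace_sub, hN.2.trace_tensorMap_id, (isChannel_swapChannel d).2.trace_tensorMap_id,
    Matrix.sub_mulVec, dotProduct_sub, key, key, swapFidelity_swapChannel hd]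
  simp

end Diamond

/-! ### Appending a resource state -/

section Attach

variable {a b r s a' b' : Type}

theorem attach_apply (ρ : Op (r × s)) (X : Op (a × b)) (p q : (a × r) × (b × s)) :
    attach ρ X p q = X (p.1.1, p.2.1) (q.1.1, q.2.1) * ρ (p.1.2, p.2.2) (q.1.2, q.2.2) := rfl

theorem attach_add (ρ σ : Op (r × s)) :
    (attach (ρ + σ) : SuperOp (a × b) _) = attach ρ + attach σ := by
  ext1 X
  ext p q
  simp [attach_apply, mul_add]

theorem attach_smul (z : ℂ) (ρ : Op (r × s)) :
    (attach (z • ρ) : SuperOp (a × b) _) = z • attach ρ := by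
  ext1 X
  ext p q
  simp [attach_apply, mul_left_comm]

/-- `attach` as a linear map in the resource. -/
def attachLinear (a b r s : Type) :
    Op (r × s) →ₗ[ℂ] SuperOp (a × b) ((a × r) × (b × s)) where
  toFun := attach
  map_add' := attach_add
  map_smul' := attach_smul

variable [Fintype a] [DecidableEq a] [Fintype b] [DecidableEq b]
  [Fintype r] [DecidableEq r] [Fintype s] [DecidableEq s]
  [Fintype a'] [DecidableEq a'] [Fintype b'] [DecidableEq b']

theorem simulation_add (P : SuperOp ((a × r) × (b × s)) (a' × b')) (ρ σ : Op (r × s)) :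
    simulation P (ρ + σ) = simulation P ρ + simulation P σ := by
  rw [simulation, attach_add, LinearMap.comp_add]; rfl

theorem simulation_smul (P : SuperOp ((a × r) × (b × s)) (a' × b')) (z : ℂ) (ρ : Op (r × s)) :
    simulation P (z • ρ) = z • simulation P ρ := by
  rw [simulation, attach_smul, LinearMap.comp_smul]; rfl

/-- The Kraus operator that appends the pure resource with vector `ψ`. -/
def attachKraus {a b r s : Type} [DecidableEq a] [DecidableEq b] (ψ : r × s → ℂ) :
    Matrix ((a × r) × (b × s)) (a × b) ℂ :=
  Matrix.of fun p q => if q = (p.1.1, p.2.1) then ψ (p.1.2, p.2.2) else 0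

theorem attach_vecMulVec_eq_kraus (w : r × s → ℂ) :
    (attach (Matrix.vecMulVec w (star w)) : SuperOp (a × b) _) =
      kraus (fun _ : Unit => attachKraus w) := by
  ext1 X
  ext p q
  simp only [attach_apply, kraus_apply, Finset.univ_unique, Finset.sum_singleton, attachKraus,
    Matrix.mul_apply, Matrix.of_apply, Matrix.conjTranspose_apply, ite_mul, zero_mul,
    Finset.sum_ite_eq', Finset.mem_univ, if_true, apply_ite star, star_zero, mul_ite, mul_zero,
    Matrix.vecMulVec_apply, Pi.star_apply]
  ring

theorem isCP_attach_vecMulVec (w : r × s → ℂ) :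
    IsCP (attach (Matrix.vecMulVec w (star w)) : SuperOp (a × b) _) := by
  rw [attach_vecMulVec_eq_kraus]
  exact isCP_kraus _

theorem trace_attach (ρ : Op (r × s)) (X : Op (a × b)) :
    (attach ρ X).trace = X.trace * ρ.trace := by
  rw [← Matrix.trace_kronecker]
  exact (Equiv.prodProdProdComm a r b s).sum_comp (fun p => (X ⊗ₖ ρ) p p)

theorem eq_sum_vecMulVec {ρ : Op a} (hρ : ρ.PosSemidef) :
    ∃ w : a → a → ℂ, ρ = ∑ k, Matrix.vecMulVec (w k) (star (w k)) := by
  obtain ⟨B, rfl⟩ := exists_eq_conjTranspose_mul_self hρ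
  refine ⟨fun k i => star (B k i), ?_⟩
  ext i j
  simp [Matrix.mul_apply, Matrix.sum_apply, Matrix.vecMulVec_apply]

theorem isCP_attach {ρ : Op (r × s)} (hρ : ρ.PosSemidef) :
    IsCP (attach ρ : SuperOp (a × b) _) := by
  obtain ⟨w, rfl⟩ := eq_sum_vecMulVec hρ
  rw [show (attach (∑ k, Matrix.vecMulVec (w k) (star (w k))) : SuperOp (a × b) _) =
    ∑ k, attach (Matrix.vecMulVec (w k) (star (w k))) from
      map_sum (attachLinear a b r s) _ _]
  exact IsCP.sum _ fun k _ => isCP_attach_vecMulVec _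

theorem isChannel_simulation {P : SuperOp ((a × r) × (b × s)) (a' × b')} (hP : IsChannel P)
    {ρ : Op (r × s)} (hρ : IsState ρ) : IsChannel (simulation P ρ) := by
  refine ⟨hP.1.comp (isCP_attach hρ.1), fun X => ?_⟩
  rw [simulation, LinearMap.comp_apply, hP.2, trace_attach, hρ.2, mul_one]

theorem partialTranspose_attach (ρ : Op (r × s)) :
    partialTranspose (a × r) (b × s) ∘ₗ attach ρ ∘ₗ partialTranspose a b =
      attach (partialTranspose r s ρ) := by
  ext1 X
  ext p q
  simp [attach_apply, partialTranspose_apply]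

theorem partialTranspose_simulation (P : SuperOp ((a × r) × (b × s)) (a' × b'))
    (ρ : Op (r × s)) :
    partialTranspose a' b' ∘ₗ simulation P ρ ∘ₗ partialTranspose a b =
      simulation (partialTranspose a' b' ∘ₗ P ∘ₗ partialTranspose (a × r) (b × s))
        (partialTranspose r s ρ) := by
  rw [simulation, partialTranspose_comp_comp, partialTranspose_attach]; rfl

theorem isTP_partialTranspose : IsTP (partialTranspose a b) := fun _ => rfl

end Attach

/-! ### Fidelity bounds from positivity and from the PPT condition -/

section LowerBound

variable {d : ℕ}

theorem sum_trace_single {n : Type} [Fintype n] [DecidableEq n] {N : SuperOp n n} {c : ℝ}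
    (hN : ∀ X, (N X).trace = c * X.trace) :
    ∑ z, (N (Matrix.single z z 1)).trace = c * Fintype.card n := by
  simp [hN, mul_comm]

/-- The left side is the trace of the Choi operator, computed from the Kraus entries. -/
theorem sum_normSq_kraus {κ n : Type} [Fintype κ] [Fintype n] [DecidableEq n]
    {K : κ → Op n} {c : ℝ} (hN : ∀ X, (kraus K X).trace = c * X.trace) :
    ∑ k, ∑ o, ∑ z, ‖K k o z‖ ^ 2 = c * Fintype.card n := by
  have h := sum_trace_single hN
  have h2 : ∀ z, (kraus K (Matrix.single z z 1)).trace =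
      ((∑ k, ∑ o, ‖K k o z‖ ^ 2 : ℝ) : ℂ) := by
    intro z
    simp only [kraus_apply, Matrix.trace_sum, Complex.ofReal_sum]
    refine Finset.sum_congr rfl fun k _ => ?_
    simp only [Matrix.trace, Matrix.diag_apply]
    refine Finset.sum_congr rfl fun o _ => ?_
    simp only [Matrix.mul_apply, Matrix.single_apply, Matrix.conjTranspose_apply, ite_and,
      mul_ite, mul_one, mul_zero, Finset.sum_ite_eq, Finset.mem_univ, if_true, ite_mul, zero_mul]
    simp [Complex.mul_conj']
  simp only [h2] at h
  rw [← Complex.ofReal_sum] at h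
  have h3 : ∑ z, ∑ k, ∑ o, ‖K k o z‖ ^ 2 = c * Fintype.card n := by exact_mod_cast h
  rw [← h3, Finset.sum_comm (s := (Finset.univ : Finset n)) (t := (Finset.univ : Finset κ))]
  exact Finset.sum_congr rfl fun k _ => Finset.sum_comm

theorem kraus_single_apply {κ n : Type} [Fintype κ] [Fintype n] [DecidableEq n]
    (K : κ → Op n) (z z' o o' : n) :
    kraus K (Matrix.single z z' 1) o o' = ∑ k, K k o z * star (K k o' z') := by
  simp only [kraus_apply, Matrix.sum_apply]
  refine Finset.sum_congr rfl fun k _ => ?_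
  simp only [Matrix.mul_apply, Matrix.single_apply, Matrix.conjTranspose_apply, ite_and,
      mul_ite, mul_one, mul_zero, Finset.sum_ite_eq, Finset.mem_univ, if_true, ite_mul, zero_mul]

/-- In Kraus form the fidelity is d⁻⁴ ∑ₖ |Tr(S Kₖ)|²; Cauchy–Schwarz over the d² indices bounds it
by the total weight of the Kraus entries. -/
theorem swapFidelity_re_bounds (hd : 1 ≤ d) {N : SuperOp (Fin d × Fin d) (Fin d × Fin d)}
    (hN : IsCP N) {c : ℝ} (hc : ∀ X, (N X).trace = c * X.trace) :
    0 ≤ (swapFidelity N).re ∧ (swapFidelity N).re ≤ c := by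
  obtain ⟨K, rfl⟩ := hN.exists_kraus
  have hd0 : (0 : ℝ) < d := by exact_mod_cast hd
  have h1 : swapFidelity (kraus K) =
      ((1 / (d : ℝ) ^ 4 * ∑ k, ‖∑ z, K k z.swap z‖ ^ 2 : ℝ) : ℂ) := by
    simp only [swapFidelity, kraus_single_apply]
    push_cast
    congr 1
    rw [Finset.sum_congr rfl fun z _ => Finset.sum_comm, Finset.sum_comm]
    refine Finset.sum_congr rfl fun k _ => ?_
    rw [← Complex.mul_conj', map_sum, Finset.sum_mul_sum]
    rfl
  have h2 := sum_normSq_kraus hc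
  rw [h1, Complex.ofReal_re]
  refine ⟨by positivity, ?_⟩
  have h3 : ∀ k, ‖∑ z : Fin d × Fin d, K k z.swap z‖ ^ 2 ≤
      d ^ 2 * ∑ o, ∑ z, ‖K k o z‖ ^ 2 := by
    intro k
    calc ‖∑ z : Fin d × Fin d, K k z.swap z‖ ^ 2 ≤ (∑ z : Fin d × Fin d, ‖K k z.swap z‖) ^ 2 := by
          gcongr; exact norm_sum_le _ _
      _ ≤ (Finset.univ : Finset (Fin d × Fin d)).card * ∑ z : Fin d × Fin d, ‖K k z.swap z‖ ^ 2 :=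
          sq_sum_le_card_mul_sum_sq
      _ ≤ _ := by
          rw [Finset.card_univ, Fintype.card_prod, Fintype.card_fin, Finset.sum_comm]
          push_cast
          rw [← pow_two]
          gcongr with z
          exact Finset.single_le_sum (f := fun o => ‖K k o z‖ ^ 2) (fun _ _ => sq_nonneg _)
            (Finset.mem_univ _)
  have h4 : ∑ k, ‖∑ z : Fin d × Fin d, K k z.swap z‖ ^ 2 ≤ d ^ 2 * (c * d ^ 2) := by
    refine (Finset.sum_le_sum fun k _ => h3 k).trans (le_of_eq ?_)
    rw [← Finset.mul_sum, h2]
    simp [pow_two]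
  rw [one_div, inv_mul_le_iff₀ (by positivity)]
  linarith

theorem swapFidelity_eq_partialTranspose (N : SuperOp (Fin d × Fin d) (Fin d × Fin d)) :
    swapFidelity N = (1 / (d : ℂ) ^ 4) * ∑ z : Fin d × Fin d, ∑ z' : Fin d × Fin d,
      (partialTranspose (Fin d) (Fin d) ∘ₗ N ∘ₗ partialTranspose (Fin d) (Fin d))
        (Matrix.single z z' 1) z'.swap z.swap := by
  simp only [swapFidelity, Fintype.sum_prod_type, LinearMap.comp_apply, partialTranspose_single,
    partialTranspose_apply, Prod.swap_prod_mk]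
  congr 1
  refine Finset.sum_congr rfl fun x _ => ?_
  rw [Finset.sum_comm]
  conv_rhs => rw [Finset.sum_comm]
  refine Finset.sum_congr rfl fun x' _ => ?_
  rw [Finset.sum_comm]

/-- After partial transposition the fidelity pairs the Choi operator with a flip, of operator norm
1, instead of a rank-one operator of norm d². This gains the factor 1/d²; in Kraus entries it is the
inequality 2xy ≤ x² + y². -/
theorem abs_swapFidelity_re_le (hd : 1 ≤ d) {N : SuperOp (Fin d × Fin d) (Fin d × Fin d)}
    (hN : IsCP (partialTranspose (Fin d) (Fin d) ∘ₗ N ∘ₗ partialTranspose (Fin d) (Fin d)))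
    {c : ℝ} (hc : ∀ X, (N X).trace = c * X.trace) :
    |(swapFidelity N).re| ≤ c / d ^ 2 := by
  have hd0 : (0 : ℝ) < d := by exact_mod_cast hd
  rw [swapFidelity_eq_partialTranspose]
  have hc' : ∀ X, ((partialTranspose (Fin d) (Fin d) ∘ₗ N ∘ₗ
      partialTranspose (Fin d) (Fin d)) X).trace = c * X.trace := fun X => hc _
  obtain ⟨K, hK⟩ := hN.exists_kraus
  rw [hK] at hc' ⊢
  have h2 := sum_normSq_kraus hc'
  refine (Complex.abs_re_le_norm _).trans ?_
  simp only [kraus_single_apply]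
  rw [norm_mul]
  have h3 : ‖∑ z : Fin d × Fin d, ∑ z' : Fin d × Fin d,
      ∑ k, K k z'.swap z * star (K k z.swap z')‖ ≤ ∑ k, ∑ o, ∑ z, ‖K k o z‖ ^ 2 := by
    calc _ ≤ ∑ z : Fin d × Fin d, ∑ z' : Fin d × Fin d, ∑ k,
          (‖K k z'.swap z‖ ^ 2 / 2 + ‖K k z.swap z'‖ ^ 2 / 2) := by
          refine (norm_sum_le _ _).trans (Finset.sum_le_sum fun z _ => ?_)
          refine (norm_sum_le _ _).trans (Finset.sum_le_sum fun z' _ => ?_)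
          refine (norm_sum_le _ _).trans (Finset.sum_le_sum fun k _ => ?_)
          rw [norm_mul, norm_star]
          nlinarith [sq_nonneg (‖K k z'.swap z‖ - ‖K k z.swap z'‖)]
      _ = ∑ z : Fin d × Fin d, ∑ z' : Fin d × Fin d, ∑ k, ‖K k z'.swap z‖ ^ 2 := by
          simp only [Finset.sum_add_distrib, ← Finset.sum_div]
          rw [Finset.sum_comm (f := fun z z' => ∑ k, ‖K k (Prod.swap z) z'‖ ^ 2)]
          ring
      _ = _ := by
          rw [Finset.sum_congr rfl fun z _ => Finset.sum_comm, Finset.sum_comm]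
          refine Finset.sum_congr rfl fun k _ => ?_
          rw [Finset.sum_comm]
          exact (Equiv.prodComm (Fin d) (Fin d)).sum_comp (fun o => ∑ z, ‖K k o z‖ ^ 2)
  rw [h2] at h3
  have h4 : ‖1 / (d : ℂ) ^ 4‖ = 1 / (d : ℝ) ^ 4 := by simp
  rw [h4, div_mul_eq_mul_div, one_mul, div_le_div_iff₀ (by positivity) (by positivity)]
  have h5 : ((Fintype.card (Fin d × Fin d) : ℕ) : ℝ) = d ^ 2 := by simp [pow_two]
  rw [h5] at h3
  nlinarith [pow_pos hd0 2]

end LowerBound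

/-! ### Maximally entangled state, swap operator and isotropic states -/

section Isotropic

theorem maxEntangled_apply (D : ℕ) (p q : Fin D × Fin D) :
    maxEntangled D p q = if p.1 = p.2 ∧ q.1 = q.2 then 1 / (D : ℂ) else 0 := by
  obtain ⟨x, y⟩ := p
  obtain ⟨x', y'⟩ := q
  simp only [maxEntangled, Matrix.single_kronecker_single, Matrix.smul_apply, Matrix.sum_apply,
    mul_one]
  rw [Finset.sum_eq_single x, Finset.sum_eq_single x']
  · by_cases h1 : x = y <;> by_cases h2 : x' = y' <;> simp [h1, h2]
  · intro j _ hj; simp [hj]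
  · simp
  · intro i _ hi; simp [hi]
  · simp

theorem maxEntangled_eq_vecMulVec (D : ℕ) :
    maxEntangled D = (1 / (D : ℂ)) • Matrix.vecMulVec
      (fun p : Fin D × Fin D => if p.1 = p.2 then (1 : ℂ) else 0)
      (star fun p : Fin D × Fin D => if p.1 = p.2 then (1 : ℂ) else 0) := by
  ext p q
  rw [maxEntangled_apply]
  by_cases h1 : p.1 = p.2 <;> by_cases h2 : q.1 = q.2 <;>
    simp [h1, h2, Matrix.vecMulVec_apply]

theorem posSemidef_maxEntangled (D : ℕ) : (maxEntangled D).PosSemidef := by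
  rw [maxEntangled_eq_vecMulVec]
  have h : (0 : ℂ) ≤ 1 / (D : ℂ) := by
    have : (1 / (D : ℂ)) = ((1 / (D : ℝ) : ℝ) : ℂ) := by push_cast; rfl
    rw [this]
    exact Complex.zero_le_real.mpr (by positivity)
  exact (Matrix.posSemidef_vecMulVec_self_star _).smul h

theorem trace_maxEntangled {D : ℕ} (hD : 1 ≤ D) : (maxEntangled D).trace = 1 := by
  have h : (D : ℂ) ≠ 0 := by exact_mod_cast (by omega : D ≠ 0)
  simp [Matrix.trace, maxEntangled_apply, Fintype.sum_prod_type, h]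

theorem maxEntangled_mul_self {D : ℕ} (hD : 1 ≤ D) :
    maxEntangled D * maxEntangled D = maxEntangled D := by
  have h : (D : ℂ) ≠ 0 := by exact_mod_cast (by omega : D ≠ 0)
  ext p q
  by_cases h1 : p.1 = p.2 <;> by_cases h2 : q.1 = q.2 <;>
    simp [Matrix.mul_apply, maxEntangled_apply, Fintype.sum_prod_type, h, h1, h2]

theorem posSemidef_one_sub_maxEntangled {D : ℕ} (hD : 1 ≤ D) :
    (1 - maxEntangled D).PosSemidef := by
  have h := Matrix.posSemidef_conjTranspose_mul_self (1 - maxEntangled D)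
  rwa [Matrix.conjTranspose_sub, Matrix.conjTranspose_one, (posSemidef_maxEntangled D).1.eq,
    mul_sub, mul_one, sub_mul, one_mul, maxEntangled_mul_self hD, sub_self, sub_zero] at h

theorem trace_one_prod (D : ℕ) : (1 : Op (Fin D × Fin D)).trace = (D : ℂ) ^ 2 := by
  simp [Matrix.trace_one, pow_two]

theorem isState_isotropicState {D : ℕ} (hD : 2 ≤ D) {F : ℝ} (hF0 : 0 ≤ F) (hF1 : F ≤ 1) :
    IsState (isotropicState D F) := by
  have hD' : (2 : ℝ) ≤ D := by exact_mod_cast hD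
  have h0 : (0 : ℝ) < (D : ℝ) ^ 2 - 1 := by nlinarith
  have h0' : (D : ℂ) ^ 2 - 1 ≠ 0 := by exact_mod_cast h0.ne'
  refine ⟨?_, ?_⟩
  · have h : ((1 - F : ℂ) / ((D : ℂ) ^ 2 - 1)) = (((1 - F) / ((D : ℝ) ^ 2 - 1) : ℝ) : ℂ) := by
      push_cast; rfl
    rw [isotropicState, h]
    exact ((posSemidef_maxEntangled D).smul (Complex.zero_le_real.mpr hF0)).add
      ((posSemidef_one_sub_maxEntangled (by omega)).smul
        (Complex.zero_le_real.mpr (div_nonneg (by linarith) h0.le)))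
  · rw [isotropicState, Matrix.trace_add, Matrix.trace_smul, Matrix.trace_smul,
      Matrix.trace_sub, trace_maxEntangled (by omega), trace_one_prod]
    simp only [smul_eq_mul]
    field_simp
    ring

theorem swapOp_mul_self (D : ℕ) : swapOp D * swapOp D = 1 := by
  ext p q
  simp only [Matrix.mul_apply, swapOp_apply, Matrix.one_apply]
  simp

theorem swapOp_conjTranspose (D : ℕ) : (swapOp D)ᴴ = swapOp D := by
  ext p q
  simp only [Matrix.conjTranspose_apply, swapOp_apply]
  by_cases h : p = q.swap
  · simp [h]
  · have : q ≠ p.swap := fun h' => h (by rw [h', Prod.swap_swap])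
    simp [h, this]

theorem trace_swapOp (D : ℕ) : (swapOp D).trace = D := by
  simp only [Matrix.trace, Matrix.diag_apply, swapOp_apply, Prod.ext_iff, Fintype.sum_prod_type,
    Prod.fst_swap, Prod.snd_swap]
  have h : ∀ x y : Fin D, (x = y ∧ y = x) ↔ x = y := fun x y => ⟨fun h => h.1, fun h => ⟨h, h.symm⟩⟩
  simp [h]

/-- The swap is a Hermitian involution, so the operator is half its own square: twice the projection
onto the symmetric or antisymmetric subspace. -/
theorem posSemidef_one_add_smul_swapOp (D : ℕ) {ε : ℝ} (hε : ε ^ 2 = 1) :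
    (1 + (ε : ℂ) • swapOp D).PosSemidef := by
  have h := Matrix.posSemidef_conjTranspose_mul_self (1 + (ε : ℂ) • swapOp D)
  have h2 := h.smul (Complex.zero_le_real.mpr (by norm_num : (0 : ℝ) ≤ 1 / 2))
  convert h2 using 1
  have hε' : (ε : ℂ) * ε = 1 := by rw [← pow_two]; exact_mod_cast hε
  rw [Matrix.conjTranspose_add, Matrix.conjTranspose_one, Matrix.conjTranspose_smul,
    swapOp_conjTranspose, mul_add, mul_one, add_mul, one_mul, Matrix.smul_mul, Matrix.mul_smul,
    swapOp_mul_self, smul_smul]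
  simp only [RCLike.star_def, Complex.conj_ofReal, hε', one_smul]
  push_cast
  module

theorem partialTranspose_swapOp {D : ℕ} (hD : 1 ≤ D) :
    partialTranspose (Fin D) (Fin D) (swapOp D) = (D : ℂ) • maxEntangled D := by
  have h : (D : ℂ) ≠ 0 := by exact_mod_cast (by omega : D ≠ 0)
  ext p q
  simp only [partialTranspose_apply, swapOp_apply, Matrix.smul_apply, maxEntangled_apply,
    Prod.ext_iff, Prod.fst_swap, Prod.snd_swap]
  by_cases h1 : p.1 = p.2 <;> by_cases h2 : q.1 = q.2 <;> simp [h1, h2, h, eq_comm]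

theorem partialTranspose_one {a b : Type} [DecidableEq a] [DecidableEq b] :
    partialTranspose a b 1 = 1 := by
  ext p q
  simp only [partialTranspose_apply, Matrix.one_apply, Prod.ext_iff]
  congr 1
  simp [eq_comm]

end Isotropic

/-! ### The linear program bounding the simulation fidelity -/

section Fidelity

variable {d D : ℕ}

/-- The entanglement fidelity with the swap channel of the simulation by `P`, as a linear
functional of the resource. -/
def simulationFidelity (P : SuperOp ((Fin d × Fin D) × (Fin d × Fin D)) (Fin d × Fin d)) :
    Op (Fin D × Fin D) →ₗ[ℂ] ℂ where
  toFun ρ := swapFidelity (simulation P ρ)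
  map_add' ρ σ := by
    simp [simulation_add, swapFidelity, Finset.sum_add_distrib, mul_add]
  map_smul' z ρ := by
    simp [simulation_smul, swapFidelity, ← Finset.mul_sum, mul_left_comm]

theorem trace_simulation {P : SuperOp ((Fin d × Fin D) × (Fin d × Fin D)) (Fin d × Fin d)}
    (hP : IsTP P) (ρ : Op (Fin D × Fin D)) (X : Op (Fin d × Fin d)) :
    (simulation P ρ X).trace = ρ.trace * X.trace := by
  rw [simulation, LinearMap.comp_apply, hP, trace_attach, mul_comm]

theorem simulationFidelity_bounds (hd : 1 ≤ d)
    {P : SuperOp ((Fin d × Fin D) × (Fin d × Fin D)) (Fin d × Fin d)}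
    (hP : IsChannel P) {ρ : Op (Fin D × Fin D)} (hρ : IsState ρ) :
    0 ≤ (simulationFidelity P ρ).re ∧ (simulationFidelity P ρ).re ≤ 1 :=
  swapFidelity_re_bounds hd (isChannel_simulation hP hρ).1 fun X => by
    rw [trace_simulation hP.2, hρ.2, Complex.ofReal_one]

/-- The partial transpose of `σ` need not be positive, but transposing the whole simulation turns it
into the partially transposed `P` with resource `σ`, which is completely positive. -/
theorem abs_simulationFidelity_le (hd : 1 ≤ d)
    {P : SuperOp ((Fin d × Fin D) × (Fin d × Fin D)) (Fin d × Fin d)}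
    (hP : IsCPPTP P) {σ : Op (Fin D × Fin D)} (hσ : σ.PosSemidef) {c : ℝ} (hc : σ.trace = c) :
    |(simulationFidelity P (partialTranspose (Fin D) (Fin D) σ)).re| ≤ c / d ^ 2 := by
  refine abs_swapFidelity_re_le hd ?_ fun X => ?_
  · rw [partialTranspose_simulation, ← LinearMap.comp_apply (partialTranspose _ _),
      partialTranspose_comp_self]
    exact hP.2.comp (isCP_attach hσ)
  · rw [trace_simulation hP.1.2, isTP_partialTranspose, hc]

theorem exists_simulationFidelity_isotropicState_eq (hd : 1 ≤ d) (hD : 2 ≤ D) {F : ℝ}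
    {P : SuperOp ((Fin d × Fin D) × (Fin d × Fin D)) (Fin d × Fin d)} (hP : IsCPPTP P) :
    ∃ t v : ℝ, 0 ≤ v ∧ v ≤ 1 ∧ |t + D * v| ≤ (D ^ 2 + D) / d ^ 2 ∧
      |t - D * v| ≤ (D ^ 2 - D) / d ^ 2 ∧
      (simulationFidelity P (isotropicState D F)).re =
        F * v + (1 - F) / (D ^ 2 - 1) * (t - v) := by
  obtain ⟨h1, h2⟩ := simulationFidelity_bounds hd hP.1
    ⟨posSemidef_maxEntangled D, trace_maxEntangled (by omega)⟩
  -- Here σ = 1 + ε · swap, of trace D² + εD, has partial transpose 1 + εDΦ.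
  have key : ∀ ε : ℝ, ε ^ 2 = 1 →
      |(simulationFidelity P 1).re + ε * (D * (simulationFidelity P (maxEntangled D)).re)| ≤
        (D ^ 2 + ε * D) / d ^ 2 := by
    intro ε hε
    have h := abs_simulationFidelity_le hd hP (posSemidef_one_add_smul_swapOp D hε)
      (c := D ^ 2 + ε * D) (by
        rw [Matrix.trace_add, Matrix.trace_smul, trace_one_prod, trace_swapOp]; simp)
    rw [map_add, map_smul, partialTranspose_one, partialTranspose_swapOp (by omega), map_add,
      map_smul, map_smul] at h
    simpa using h
  refine ⟨_, _, h1, h2, by simpa using key 1 (by norm_num), ?_, ?_⟩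
  · have := key (-1) (by norm_num)
    simpa [sub_eq_add_neg] using this
  · have h : ((1 - F : ℂ) / ((D : ℂ) ^ 2 - 1)) = (((1 - F) / ((D : ℝ) ^ 2 - 1) : ℝ) : ℂ) := by
      push_cast; rfl
    rw [isotropicState, h, map_add, map_smul, map_smul, map_sub]
    simp only [smul_eq_mul, Complex.add_re, Complex.re_ofReal_mul, Complex.sub_re]

/-- The objective is a combination of t + Dv and t - Dv; both multipliers are nonnegative because F
≤ 1/D, so the two upper bounds add up. -/
theorem fidelity_le_of_le {D d F t v : ℝ} (hD : 2 ≤ D) (hd : 1 ≤ d) (hF : F ≤ 1 / D) (hF0 : 0 ≤ F)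
    (h1 : |t + D * v| ≤ (D ^ 2 + D) / d ^ 2) (h2 : |t - D * v| ≤ (D ^ 2 - D) / d ^ 2) :
    F * v + (1 - F) / (D ^ 2 - 1) * (t - v) ≤ 1 / d ^ 2 := by
  have e : F * v + (1 - F) / (D ^ 2 - 1) * (t - v) =
      (t + D * v) * ((F + 1 / D) / (D + 1) / 2) + (t - D * v) * ((1 / D - F) / (D - 1) / 2) := by
    have : D ^ 2 - 1 ≠ 0 := by nlinarith
    have : D - 1 ≠ 0 := by linarith
    have : D + 1 ≠ 0 := by linarith
    have : D ≠ 0 := by linarith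
    rw [show D ^ 2 - 1 = (D - 1) * (D + 1) by ring]
    field_simp
    ring
  have e2 : 1 / d ^ 2 = (D ^ 2 + D) / d ^ 2 * ((F + 1 / D) / (D + 1) / 2) +
      (D ^ 2 - D) / d ^ 2 * ((1 / D - F) / (D - 1) / 2) := by
    have : D - 1 ≠ 0 := by linarith
    have : D + 1 ≠ 0 := by linarith
    have : D ≠ 0 := by linarith
    have : d ≠ 0 := by linarith
    field_simp
    ring
  rw [e, e2]
  have p1 : 0 ≤ (F + 1 / D) / (D + 1) / 2 := by positivity
  have p2 : 0 ≤ (1 / D - F) / (D - 1) / 2 :=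
    div_nonneg (div_nonneg (by linarith) (by linarith)) (by norm_num)
  exact add_le_add (mul_le_mul_of_nonneg_right (le_of_abs_le h1) p1)
    (mul_le_mul_of_nonneg_right (le_of_abs_le h2) p2)

/-- For F > 1/D the multiplier of t - Dv is negative, so the lower bound on t - Dv is used instead.
-/
theorem fidelity_le_of_lt {D d F t v : ℝ} (hD : 2 ≤ D) (hd : 1 ≤ d) (hF : 1 / D < F)
    (h1 : |t + D * v| ≤ (D ^ 2 + D) / d ^ 2) (h2 : |t - D * v| ≤ (D ^ 2 - D) / d ^ 2) :
    F * v + (1 - F) / (D ^ 2 - 1) * (t - v) ≤ F * D / d ^ 2 := by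
  have e : F * v + (1 - F) / (D ^ 2 - 1) * (t - v) =
      (t + D * v) * ((F + 1 / D) / (D + 1) / 2) + (-(t - D * v)) * ((F - 1 / D) / (D - 1) / 2) := by
    have : D ^ 2 - 1 ≠ 0 := by nlinarith
    have : D - 1 ≠ 0 := by linarith
    have : D + 1 ≠ 0 := by linarith
    have : D ≠ 0 := by linarith
    rw [show D ^ 2 - 1 = (D - 1) * (D + 1) by ring]
    field_simp
    ring
  have e2 : F * D / d ^ 2 = (D ^ 2 + D) / d ^ 2 * ((F + 1 / D) / (D + 1) / 2) +
      (D ^ 2 - D) / d ^ 2 * ((F - 1 / D) / (D - 1) / 2) := by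
    have : D - 1 ≠ 0 := by linarith
    have : D + 1 ≠ 0 := by linarith
    have : D ≠ 0 := by linarith
    have : d ≠ 0 := by linarith
    field_simp
    ring
  have p0 : 0 < 1 / D := by positivity
  rw [e, e2]
  have p1 : 0 ≤ (F + 1 / D) / (D + 1) / 2 :=
    div_nonneg (div_nonneg (by linarith) (by linarith)) (by norm_num)
  have p2 : 0 ≤ (F - 1 / D) / (D - 1) / 2 :=
    div_nonneg (div_nonneg (by linarith) (by linarith)) (by norm_num)
  exact add_le_add (mul_le_mul_of_nonneg_right (le_of_abs_le h1) p1)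
    (mul_le_mul_of_nonneg_right ((neg_le_abs _).trans h2) p2)

/-- Here the dual certificate combines the bound on t + Dv with v ≤ 1. -/
theorem fidelity_le_of_lt_of_le_one {D d F t v : ℝ} (hD : 2 ≤ D) (hd : 1 ≤ d) (hF : 1 / D < F)
    (hF1 : F ≤ 1) (hv : v ≤ 1)
    (h1 : |t + D * v| ≤ (D ^ 2 + D) / d ^ 2) :
    F * v + (1 - F) / (D ^ 2 - 1) * (t - v) ≤
      1 - (1 - 1 / d ^ 2) * (1 - F) / (1 - 1 / D) := by
  have n1 : D ^ 2 - 1 ≠ 0 := by nlinarith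
  have n2 : D - 1 ≠ 0 := by linarith
  have n3 : D + 1 ≠ 0 := by linarith
  have n4 : D ≠ 0 := by linarith
  have n5 : d ≠ 0 := by linarith
  have e : F * v + (1 - F) / (D ^ 2 - 1) * (t - v) =
      (t + D * v) * ((1 - F) / (D ^ 2 - 1)) + v * (D * (F - 1 / D) / (D - 1)) := by
    rw [show D ^ 2 - 1 = (D - 1) * (D + 1) by ring]
    field_simp
    ring
  have e2 : 1 - (1 - 1 / d ^ 2) * (1 - F) / (1 - 1 / D) =
      (D ^ 2 + D) / d ^ 2 * ((1 - F) / (D ^ 2 - 1)) + 1 * (D * (F - 1 / D) / (D - 1)) := by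
    rw [show D ^ 2 - 1 = (D - 1) * (D + 1) by ring, show 1 - 1 / D = (D - 1) / D by field_simp]
    field_simp
    ring
  rw [e, e2]
  have p1 : 0 ≤ (1 - F) / (D ^ 2 - 1) := div_nonneg (by linarith) (by nlinarith)
  have p2 : 0 ≤ D * (F - 1 / D) / (D - 1) :=
    div_nonneg (mul_nonneg (by linarith) (by linarith)) (by linarith)
  exact add_le_add (mul_le_mul_of_nonneg_right (le_of_abs_le h1) p1)
    (mul_le_mul_of_nonneg_right hv p2)

end Fidelity

/-! ### Heisenberg–Weyl unitaries -/

section Weyl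

/-- Orthogonality of characters: off the diagonal this is a geometric sum with ratio a d-th root of
unity other than 1. -/
theorem sum_pow_mul_star_pow {d : ℕ} {ζ : ℂ} (hζ : IsPrimitiveRoot ζ d) (hn : star ζ * ζ = 1)
    (i i' : Fin d) :
    ∑ q : Fin d, star (ζ ^ ((q : ℕ) * (i : ℕ))) * ζ ^ ((q : ℕ) * (i' : ℕ)) =
      if i = i' then (d : ℂ) else 0 := by
  have hpow : ∀ n : ℕ, star (ζ ^ n) * ζ ^ n = 1 := fun n => by
    rw [star_pow, ← mul_pow, hn, one_pow]
  split_ifs with h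
  · subst h
    simp only [hpow]
    simp
  · set η := star (ζ ^ (i : ℕ)) * ζ ^ (i' : ℕ) with hη
    have h1 : ∀ q : Fin d, star (ζ ^ ((q : ℕ) * (i : ℕ))) * ζ ^ ((q : ℕ) * (i' : ℕ)) =
        η ^ (q : ℕ) := fun q => by
      rw [hη, mul_pow, star_pow, star_pow, ← pow_mul, ← pow_mul, mul_comm (q : ℕ),
        mul_comm (q : ℕ)]
    simp only [h1]
    rw [Fin.sum_univ_eq_sum_range (fun q => η ^ q) d]
    have h2 : η ^ d = 1 := by
      rw [hη, mul_pow, ← star_pow, ← pow_mul, ← pow_mul, mul_comm (i : ℕ),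
        mul_comm (i' : ℕ), pow_mul, pow_mul, hζ.pow_eq_one]
      simp
    have h3 : η - 1 ≠ 0 := by
      intro h3
      apply h
      have h4 : ζ ^ (i' : ℕ) = ζ ^ (i : ℕ) := by
        have := hpow i
        rw [sub_eq_zero, hη] at h3
        have h5 : star (ζ ^ (i : ℕ)) ≠ 0 := fun h0 => by simp [h0] at this
        exact mul_left_cancel₀ h5 (h3.trans this.symm)
      exact Fin.ext (hζ.pow_inj i'.2 i.2 h4).symm
    have h4 := mul_geom_sum η d
    rw [h2, sub_self] at h4
    exact (mul_eq_zero.1 h4).resolve_left h3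

/-- There is an orthogonal basis of the operators on `ℂ^d` consisting of unitaries. -/
theorem exists_unitary_basis {d : ℕ} (hd : 1 ≤ d) : ∃ W : Fin (d * d) → Op (Fin d),
    (∀ w, (W w)ᴴ * W w = 1) ∧ ∀ x i x' i', ∑ w, star (W w x i) * W w x' i' =
      if x = x' ∧ i = i' then (d : ℂ) else 0 := by
  have : NeZero d := ⟨by omega⟩
  set ζ := Complex.exp (2 * Real.pi * Complex.I / d)
  have hζ : IsPrimitiveRoot ζ d := Complex.isPrimitiveRoot_exp d (by omega)
  have hn : star ζ * ζ = 1 := by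
    rw [RCLike.star_def, Complex.conj_mul', hζ.norm'_eq_one (by omega)]
    simp
  have hpow : ∀ n : ℕ, star (ζ ^ n) * ζ ^ n = 1 := fun n => by
    rw [star_pow, ← mul_pow, hn, one_pow]
  -- The cyclic shift by `w.1` after the `w.2`-th power of the clock matrix. Summing over phases
  -- forces i = i'; the shift is then determined by x - i.
  let V : Fin d × Fin d → Op (Fin d) := fun w => Matrix.of fun x i =>
    if x = i + w.1 then ζ ^ ((w.2 : ℕ) * (i : ℕ)) else 0
  refine ⟨fun w => V (finProdFinEquiv.symm w), fun w => ?_, fun x i x' i' => ?_⟩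
  · ext i j
    simp only [V, Matrix.mul_apply, Matrix.conjTranspose_apply, Matrix.of_apply, Matrix.one_apply,
      apply_ite star, star_zero, ite_mul, zero_mul, mul_ite, mul_zero, Finset.sum_ite_eq',
      Finset.mem_univ, if_true, add_left_inj]
    by_cases h : i = j
    · rw [if_pos h, if_pos h.symm, h, hpow]
    · rw [if_neg h, if_neg (Ne.symm h)]
  · rw [finProdFinEquiv.symm.sum_comp (fun w => star (V w x i) * V w x' i'),
      Fintype.sum_prod_type]
    have h1 : ∀ p : Fin d, ∑ q : Fin d, star (V (p, q) x i) * V (p, q) x' i' =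
        if x = i + p ∧ x' = i' + p then (if i = i' then (d : ℂ) else 0) else 0 := by
      intro p
      by_cases h1 : x = i + p <;> by_cases h2 : x' = i' + p <;>
        simp only [V, Matrix.of_apply, h1, h2, if_true, if_false, star_zero, mul_zero, zero_mul,
          Finset.sum_const_zero, and_self, and_true, and_false]
      exact sum_pow_mul_star_pow hζ hn i i'
    simp only [h1]
    by_cases h2 : i = i'
    · subst h2
      by_cases h3 : x = x'
      · subst h3
        have : ∀ p : Fin d, (x = i + p) ↔ p = x - i := fun p => by
          rw [eq_sub_iff_add_eq, add_comm p i, eq_comm]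
        simp [this]
      · have : ∀ p, ¬ (x = i + p ∧ x' = i + p) := fun p h => h3 (h.1.trans h.2.symm)
        simp [this, h3]
    · simp [h2]

end Weyl

/-! ### Extracting a Kraus component; local preprocessing of the resource -/

section Kraus

variable {a b c a' b' : Type} [Fintype a] [DecidableEq a] [Fintype b] [DecidableEq b]
  [Fintype c] [DecidableEq c]

/-- Averaging the Kraus operators yields a completely positive part of the map. -/
theorem isCP_kraus_sub {κ : Type} [Fintype κ] [Nonempty κ] (K : κ → Matrix b a ℂ) :
    IsCP (kraus K - (1 / (Fintype.card κ : ℂ)) • kraus (fun _ : Unit => ∑ k, K k)) := by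
  have hn : (Fintype.card κ : ℂ) ≠ 0 := by exact_mod_cast Fintype.card_ne_zero
  -- The variance identity: the difference has as Kraus operators the deviations from the mean.
  convert isCP_kraus (fun m => K m - (1 / (Fintype.card κ : ℂ)) • ∑ k, K k) using 1
  ext1 X
  simp only [LinearMap.sub_apply, LinearMap.smul_apply, kraus_apply, Finset.univ_unique,
    Finset.sum_singleton]
  set S := ∑ k, K k with hS
  have h : ∀ m, (K m - (1 / (Fintype.card κ : ℂ)) • S) * X *
      (K m - (1 / (Fintype.card κ : ℂ)) • S)ᴴ = K m * X * (K m)ᴴ -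
        (1 / (Fintype.card κ : ℂ)) • (S * X * (K m)ᴴ) -
        (1 / (Fintype.card κ : ℂ)) • (K m * X * Sᴴ) +
        ((1 / (Fintype.card κ : ℂ)) * (1 / (Fintype.card κ : ℂ))) • (S * X * Sᴴ) := by
    intro m
    rw [Matrix.conjTranspose_sub, Matrix.conjTranspose_smul]
    simp only [Matrix.sub_mul, Matrix.mul_sub, Matrix.smul_mul, Matrix.mul_smul]
    have : star (1 / (Fintype.card κ : ℂ)) = 1 / (Fintype.card κ : ℂ) := by simp
    rw [this]
    simp only [smul_sub, smul_smul]
    abel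
  simp only [h, Finset.sum_add_distrib, Finset.sum_sub_distrib, ← Finset.smul_sum,
    ← Matrix.mul_sum, ← Matrix.sum_mul, ← Matrix.conjTranspose_sum, ← hS, Finset.sum_const,
    Finset.card_univ]
  rw [← Nat.cast_smul_eq_nsmul ℂ, smul_smul]
  field_simp
  module

theorem isCP_kraus_unit [Fintype a'] (K : Matrix a' a ℂ) : IsCP (kraus fun _ : Unit => K) :=
  isCP_kraus _

theorem isTP_kraus_unit [Fintype a'] {K : Matrix a' a ℂ} (h : Kᴴ * K = 1) :
    IsTP (kraus fun _ : Unit => K) :=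
  isTP_kraus (by simpa using h)

theorem sum_kraus_unit {κ : Type} [Fintype κ] (K : κ → Matrix a' a ℂ) :
    ∑ k, kraus (fun _ : Unit => K k) = kraus K := by
  ext1 X
  simp [kraus_apply, LinearMap.sum_apply]

theorem isInstrument_kraus_unit [Fintype a'] {n : ℕ} {K : Fin n → Matrix a' a ℂ}
    (h : ∑ k, (K k)ᴴ * K k = 1) : IsInstrument (fun k => kraus fun _ : Unit => K k) :=
  ⟨fun k => isCP_kraus_unit (K k), by rw [sum_kraus_unit]; exact isTP_kraus h⟩

theorem kraus_vecMulVec {κ : Type} [Fintype κ] (K : κ → Matrix a' a ℂ) (v : a → ℂ) :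
    kraus K (Matrix.vecMulVec v (star v)) =
      ∑ k, Matrix.vecMulVec (K k *ᵥ v) (star (K k *ᵥ v)) := by
  rw [kraus_apply]
  refine Finset.sum_congr rfl fun k _ => ?_
  rw [Matrix.mul_vecMulVec, Matrix.vecMulVec_mul, Matrix.star_mulVec]

theorem tensorMap_kronecker (E : SuperOp a a') (G : SuperOp b b') (X : Op a) (Y : Op b) :
    tensorMap E G (X ⊗ₖ Y) = E X ⊗ₖ G Y := by
  rw [superOp_apply E X, superOp_apply G Y]
  ext ⟨k, l⟩ ⟨k', l'⟩
  simp only [tensorMap, LinearMap.coe_mk, AddHom.coe_mk, Matrix.sum_apply, Matrix.smul_apply,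
    Matrix.kroneckerMap_apply, smul_eq_mul, Finset.sum_mul]
  simp only [Finset.mul_sum]
  refine Finset.sum_congr rfl fun i _ => Finset.sum_congr rfl fun i' _ =>
    Finset.sum_congr rfl fun j _ => Finset.sum_congr rfl fun j' _ => ?_
  ring

theorem attach_single {r s : Type} [DecidableEq r] [DecidableEq s] (m m' : r) (n n' : s)
    (x x' : a) (y y' : b) :
    attach (Matrix.single (m, n) (m', n') 1) (Matrix.single (x, y) (x', y') 1) =
      Matrix.single ((x, m), (y, n)) ((x', m'), (y', n')) (1 : ℂ) := by
  ext ⟨⟨p, q⟩, ⟨t, u⟩⟩ ⟨⟨p', q'⟩, ⟨t', u'⟩⟩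
  simp only [attach_apply, Matrix.single_apply, Prod.mk.injEq, mul_ite, mul_one, mul_zero,
    ← ite_and]
  congr 1
  simp only [eq_iff_iff]
  tauto

/-- A local channel is an instrument with a single outcome, so preprocessing adds one round per
party. -/
theorem IsLOCC.comp_tensorMap [Fintype a'] [Fintype b'] {e f : Type} [Fintype e] [DecidableEq e]
    [Fintype f] [DecidableEq f] {L : SuperOp (a × b) (a' × b')}
    (hL : IsLOCC L) {E : SuperOp e a} {G : SuperOp f b} (hE : IsChannel E) (hG : IsChannel G) :
    IsLOCC (L ∘ₗ tensorMap E G) := by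
  have h1 := IsLOCC.bob (a := a) (fun _ : Fin 1 => G) (fun _ => L)
    ⟨fun _ => hG.1, by simpa using hG.2⟩ (fun _ => hL)
  have h2 := IsLOCC.alice (b := f) (fun _ : Fin 1 => E) _ ⟨fun _ => hE.1, by simpa using hE.2⟩
    (fun _ => h1)
  convert h2 using 1
  simp only [Finset.univ_unique, Finset.sum_singleton]
  apply superOp_ext
  rintro ⟨i, j⟩ ⟨i', j'⟩
  simp only [LinearMap.comp_apply, tensorMap_single]
  congr 1
  rw [LinearMap.id_apply, tensorMap_kronecker, LinearMap.id_apply]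

theorem simulation_comp_tensorMap {r s r' s' : Type} [Fintype r] [DecidableEq r] [Fintype s]
    [DecidableEq s] [Fintype r'] [DecidableEq r'] [Fintype s'] [DecidableEq s']
    (L : SuperOp ((a × r) × (b × s)) (a' × b')) (E : SuperOp r' r) (G : SuperOp s' s)
    (ρ : Op (r' × s')) :
    simulation (L ∘ₗ tensorMap (tensorMap (LinearMap.id : SuperOp a a) E)
      (tensorMap (LinearMap.id : SuperOp b b) G)) ρ = simulation L (tensorMap E G ρ) := by
  have key : ∀ ω : Op (a × b), tensorMap (tensorMap (LinearMap.id : SuperOp a a) E)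
      (tensorMap (LinearMap.id : SuperOp b b) G) ∘ₗ
        LinearMap.applyₗ ω ∘ₗ attachLinear a b r' s' =
      LinearMap.applyₗ ω ∘ₗ attachLinear a b r s ∘ₗ tensorMap E G := by
    intro ω
    apply superOp_ext
    rintro ⟨m, n⟩ ⟨m', n'⟩
    refine DFunLike.congr_fun (f := tensorMap (tensorMap (LinearMap.id : SuperOp a a) E)
      (tensorMap (LinearMap.id : SuperOp b b) G) ∘ₗ attach (Matrix.single (m, n) (m', n') 1))
      (g := attach (tensorMap E G (Matrix.single (m, n) (m', n') 1))) (superOp_ext ?_) ω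
    rintro ⟨x, y⟩ ⟨x', y'⟩
    rw [LinearMap.comp_apply, attach_single, tensorMap_single, tensorMap_single, tensorMap_single,
      tensorMap_single]
    ext p q
    rw [attach_apply, ← mul_one (1 : ℂ), ← Matrix.single_kronecker_single]
    simp only [Matrix.kroneckerMap_apply, LinearMap.id_apply, mul_one]
    ring
  ext1 ω
  exact congrArg L (DFunLike.congr_fun (key ω) ρ)

end Kraus

/-! ### Bidirectional teleportation -/

section Teleportation

variable {d : ℕ}

/-- Alice's Kraus operator: projection of her input and the first half of her resource onto the
maximally entangled vector twisted by `U`. -/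
def aliceKraus (U : Op (Fin d)) : Matrix (Fin d) (Fin d × (Fin d × Fin d)) ℂ :=
  Matrix.of fun k p => if k = p.2.2 then (1 / (Real.sqrt d : ℂ)) * star (U p.1 p.2.1) else 0

/-- Bob's Kraus operator: projection of his input and the second half of his resource onto the
maximally entangled vector twisted by `V`, followed by the correction `U`. -/
def bobKraus (U V : Op (Fin d)) : Matrix (Fin d) (Fin d × (Fin d × Fin d)) ℂ :=
  Matrix.of fun k p => (1 / (Real.sqrt d : ℂ)) * star (V p.1 p.2.2) * U k p.2.1

theorem star_sqrt_mul_sqrt (d : ℕ) :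
    star (1 / (Real.sqrt d : ℂ)) * (1 / (Real.sqrt d : ℂ)) = 1 / d := by
  have h : (Real.sqrt d : ℂ) * Real.sqrt d = d := by
    rw [← Complex.ofReal_mul, Real.mul_self_sqrt (Nat.cast_nonneg d)]
    simp
  rw [RCLike.star_def, map_div₀, Complex.conj_ofReal, map_one, div_mul_div_comm, h, one_mul]

theorem sum_aliceKraus (hd : 1 ≤ d) {n : ℕ} {W : Fin n → Op (Fin d)}
    (hW : ∀ x i x' i', ∑ w, star (W w x i) * W w x' i' =
      if x = x' ∧ i = i' then (d : ℂ) else 0) :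
    ∑ w, (aliceKraus (W w))ᴴ * aliceKraus (W w) = 1 := by
  have hd0 : (d : ℂ) ≠ 0 := by exact_mod_cast (by omega : d ≠ 0)
  ext ⟨x, i, k⟩ ⟨x', i', k'⟩
  simp only [Matrix.sum_apply, Matrix.mul_apply, Matrix.conjTranspose_apply, aliceKraus,
    Matrix.of_apply]
  by_cases hk : k = k'
  · subst hk
    have h1 : ∀ w, ∑ j, star (if j = k then 1 / (Real.sqrt d : ℂ) * star (W w x i) else 0) *
        (if j = k then 1 / (Real.sqrt d : ℂ) * star (W w x' i') else 0) =
        (star (1 / (Real.sqrt d : ℂ)) * (1 / (Real.sqrt d : ℂ))) *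
          (star (W w x' i') * W w x i) := by
      intro w
      rw [Finset.sum_eq_single k]
      · simp only [if_true, star_mul', star_star]
        ring
      · intro j _ hj; simp [hj]
      · simp
    simp only [h1]
    rw [← Finset.mul_sum, hW, star_sqrt_mul_sqrt d, Matrix.one_apply]
    by_cases hx : x = x' <;> by_cases hi : i = i' <;>
      simp [hx, hi, hd0, eq_comm]
  · have h1 : ∀ j, ¬ (j = k ∧ j = k') := fun j h => hk (h.1.symm.trans h.2)
    rw [Matrix.one_apply, if_neg (by simp [hk])]
    refine Finset.sum_eq_zero fun w _ => Finset.sum_eq_zero fun j _ => ?_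
    by_cases h2 : j = k
    · rw [if_neg (fun h3 => h1 j ⟨h2, h3⟩), mul_zero]
    · rw [if_neg h2, star_zero, zero_mul]

theorem sum_bobKraus (hd : 1 ≤ d) {n : ℕ} {W : Fin n → Op (Fin d)}
    (hW : ∀ x i x' i', ∑ w, star (W w x i) * W w x' i' =
      if x = x' ∧ i = i' then (d : ℂ) else 0) {U : Op (Fin d)} (hU : Uᴴ * U = 1) :
    ∑ w, (bobKraus U (W w))ᴴ * bobKraus U (W w) = 1 := by
  have hd0 : (d : ℂ) ≠ 0 := by exact_mod_cast (by omega : d ≠ 0)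
  ext ⟨x, i, k⟩ ⟨x', i', k'⟩
  simp only [Matrix.sum_apply, Matrix.mul_apply, Matrix.conjTranspose_apply, bobKraus,
    Matrix.of_apply]
  have hU' : ∑ j, star (U j i) * U j i' = if i = i' then 1 else 0 := by
    have := congrFun (congrFun hU i) i'
    rwa [Matrix.mul_apply, Matrix.one_apply] at this
  have h1 : ∀ w, ∑ j, star (1 / (Real.sqrt d : ℂ) * star (W w x k) * U j i) *
      (1 / (Real.sqrt d : ℂ) * star (W w x' k') * U j i') =
      (star (1 / (Real.sqrt d : ℂ)) * (1 / (Real.sqrt d : ℂ))) *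
          (star (W w x' k') * W w x k) * ∑ j, star (U j i) * U j i' := by
    intro w
    rw [Finset.mul_sum]
    refine Finset.sum_congr rfl fun j _ => ?_
    simp only [star_mul', star_star]
    ring
  simp only [h1]
  rw [← Finset.sum_mul, ← Finset.mul_sum, hW, star_sqrt_mul_sqrt d, hU', Matrix.one_apply]
  by_cases hx : x = x' <;> by_cases hi : i = i' <;> by_cases hk : k = k' <;>
    simp [hx, hi, hk, hd0, eq_comm]

/-- The bidirectional teleportation protocol. -/
def teleportation {n : ℕ} (W : Fin n → Op (Fin d)) :
    SuperOp ((Fin d × (Fin d × Fin d)) × (Fin d × (Fin d × Fin d))) (Fin d × Fin d) :=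
  ∑ w, (∑ v, tensorMap (kraus fun _ : Unit => W v) (LinearMap.id : SuperOp (Fin d) (Fin d)) ∘ₗ
    tensorMap (LinearMap.id : SuperOp (Fin d) (Fin d)) (kraus fun _ : Unit => bobKraus (W w) (W v)))
    ∘ₗ tensorMap (kraus fun _ : Unit => aliceKraus (W w)) (LinearMap.id : SuperOp _ _)

theorem isLOCC_teleportation (hd : 1 ≤ d) {n : ℕ} {W : Fin n → Op (Fin d)}
    (hW1 : ∀ w, (W w)ᴴ * W w = 1)
    (hW : ∀ x i x' i', ∑ w, star (W w x i) * W w x' i' =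
      if x = x' ∧ i = i' then (d : ℂ) else 0) : IsLOCC (teleportation W) := by
  refine IsLOCC.alice _ _ (isInstrument_kraus_unit (sum_aliceKraus hd hW)) fun w => ?_
  refine IsLOCC.bob _ _ (isInstrument_kraus_unit (sum_bobKraus hd hW (hW1 w))) fun v => ?_
  exact IsLOCC.localOps _ _ ⟨isCP_kraus _, isTP_kraus_unit (hW1 v)⟩ ⟨IsCP.id, IsTP.id⟩

/-- The Kraus operators of bidirectional teleportation. -/
def teleportationKraus (U V : Op (Fin d)) :
    Matrix (Fin d × Fin d) ((Fin d × (Fin d × Fin d)) × (Fin d × (Fin d × Fin d))) ℂ :=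
  (V * aliceKraus U) ⊗ₖ bobKraus U V

theorem teleportation_eq_kraus {n : ℕ} (W : Fin n → Op (Fin d)) :
    teleportation W = kraus fun x : Fin n × Fin n =>
      teleportationKraus (W x.1) (W x.2) := by
  rw [← sum_kraus_unit, Fintype.sum_prod_type, teleportation]
  refine Finset.sum_congr rfl fun w _ => ?_
  have h : ∀ (M : Fin n → SuperOp (Fin d × (Fin d × (Fin d × Fin d))) (Fin d × Fin d))
      (N : SuperOp ((Fin d × (Fin d × Fin d)) × (Fin d × (Fin d × Fin d)))
        (Fin d × (Fin d × (Fin d × Fin d)))), (∑ v, M v) ∘ₗ N = ∑ v, M v ∘ₗ N := fun M N => by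
    ext1 X
    simp [LinearMap.sum_apply]
  rw [h]
  refine Finset.sum_congr rfl fun v _ => ?_
  rw [← kraus_one, ← kraus_one, tensorMap_kraus, tensorMap_kraus, tensorMap_kraus,
    kraus_comp_kraus, kraus_comp_kraus]
  ext1 X
  simp only [kraus_apply, Finset.univ_unique, Finset.sum_singleton, Fintype.sum_prod_type,
    ← Matrix.mul_kronecker_mul, Matrix.one_mul, Matrix.mul_one, teleportationKraus]

/-- The completeness relation `hW`, used once per direction, sends Alice's input to Bob and Bob's to
Alice and contracts the resource indices. The two factors d and the measurement factor 1/d leave d.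
-/
theorem sum_teleportation_kraus (hd : 1 ≤ d) {n : ℕ} {W : Fin n → Op (Fin d)}
    (hW : ∀ x i x' i', ∑ w, star (W w x i) * W w x' i' =
      if x = x' ∧ i = i' then (d : ℂ) else 0) (ψ : (Fin d × Fin d) × (Fin d × Fin d) → ℂ) :
    ∑ x : Fin n × Fin n, teleportationKraus (W x.1) (W x.2) *
      (attachKraus ψ : Matrix _ (Fin d × Fin d) ℂ) =
    ((d : ℂ) * ∑ p, ψ (p, p)) • swapOp d := by
  have hd0 : (d : ℂ) ≠ 0 := by exact_mod_cast (by omega : d ≠ 0)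
  have hs : (1 / (Real.sqrt d : ℂ)) * (1 / (Real.sqrt d : ℂ)) = 1 / d := by
    have := star_sqrt_mul_sqrt d
    rwa [RCLike.star_def, map_div₀, Complex.conj_ofReal, map_one] at this
  have hWA : ∀ (U V : Op (Fin d)) (a : Fin d) (p : Fin d × (Fin d × Fin d)),
      (V * aliceKraus U) a p = (1 / (Real.sqrt d : ℂ)) * star (U p.1 p.2.1) * V a p.2.2 := by
    intro U V a p
    simp only [Matrix.mul_apply, aliceKraus, Matrix.of_apply, mul_ite, mul_zero,
      Finset.sum_ite_eq', Finset.mem_univ, if_true]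
    ring
  ext ⟨a, b⟩ ⟨x, y⟩
  have h1 : ∀ u : Fin n × Fin n,
      (teleportationKraus (W u.1) (W u.2) *
        (attachKraus ψ : Matrix _ (Fin d × Fin d) ℂ)) (a, b) (x, y) =
      ∑ p : Fin d × Fin d, ∑ q : Fin d × Fin d, (1 / d : ℂ) * ψ (p, q) *
        ((star (W u.1 x p.1) * W u.1 b q.1) * (star (W u.2 y q.2) * W u.2 a p.2)) := by
    intro u
    rw [Matrix.mul_apply, Fintype.sum_prod_type, Fintype.sum_prod_type,
      Finset.sum_eq_single x]
    · refine Finset.sum_congr rfl fun p _ => ?_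
      rw [Fintype.sum_prod_type, Finset.sum_eq_single y]
      · refine Finset.sum_congr rfl fun q _ => ?_
        rw [← hs]
        simp only [teleportationKraus, Matrix.kroneckerMap_apply, hWA, bobKraus,
          attachKraus, Matrix.of_apply, if_true]
        ring
      · intro y' _ hy; simp [attachKraus, hy.symm]
      · simp
    · intro x' _ hx; simp [attachKraus, hx.symm]
    · simp
  rw [Matrix.sum_apply]
  simp only [h1]
  rw [Finset.sum_comm, Finset.sum_congr rfl fun p _ => Finset.sum_comm]
  have h2 : ∀ p q : Fin d × Fin d, ∑ u : Fin n × Fin n, (1 / d : ℂ) * ψ (p, q) *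
        ((star (W u.1 x p.1) * W u.1 b q.1) * (star (W u.2 y q.2) * W u.2 a p.2)) =
      (1 / d : ℂ) * ψ (p, q) * ((if x = b ∧ p.1 = q.1 then (d : ℂ) else 0) *
        (if y = a ∧ q.2 = p.2 then (d : ℂ) else 0)) := by
    intro p q
    rw [← Finset.mul_sum, ← hW, ← hW, Finset.sum_mul_sum, Fintype.sum_prod_type]
  simp only [h2]
  rw [Matrix.smul_apply, swapOp_apply]
  by_cases hx : x = b
  · by_cases hy : y = a
    · rw [if_pos (by simp [hx, hy]), smul_eq_mul, mul_one, Finset.mul_sum]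
      refine Finset.sum_congr rfl fun p _ => ?_
      rw [Finset.sum_eq_single p]
      · simp [hx, hy]
        field_simp
      · intro q _ hq
        by_cases h3 : p.1 = q.1
        · have : q.2 ≠ p.2 := fun h => hq (Prod.ext h3.symm h)
          simp [this]
        · simp [h3]
      · simp
    · rw [if_neg (by simp [Prod.ext_iff, Ne.symm hy])]
      simp [hy]
  · rw [if_neg (by simp [Prod.ext_iff, Ne.symm hx])]
    simp [hx]

/-- There are d⁴ outcome pairs and the Kraus operators add up to d (∑ ψ(p,p)) times the swap, so
`isCP_kraus_sub` gives the weight d² |∑ ψ(p,p)|² / d⁴. The protocol does not depend on `ψ`. -/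
theorem exists_isLOCC_sub_smul_swapChannel (hd : 1 ≤ d) :
    ∃ L : SuperOp ((Fin d × (Fin d × Fin d)) × (Fin d × (Fin d × Fin d))) (Fin d × Fin d),
      IsLOCC L ∧ ∀ ψ : (Fin d × Fin d) × (Fin d × Fin d) → ℂ,
        IsCP (simulation L (Matrix.vecMulVec ψ (star ψ)) -
          ((‖∑ p, ψ (p, p)‖ ^ 2 / (d : ℝ) ^ 2 : ℝ) : ℂ) • swapChannel d) := by
  have hd0 : (d : ℂ) ≠ 0 := by exact_mod_cast (by omega : d ≠ 0)
  have : NeZero d := ⟨by omega⟩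
  have : NeZero (d * d) := ⟨by positivity⟩
  obtain ⟨W, hW1, hW⟩ := exists_unitary_basis hd
  refine ⟨teleportation W, isLOCC_teleportation hd hW1 hW, fun ψ => ?_⟩
  have h := isCP_kraus_sub (fun x : Fin (d * d) × Fin (d * d) =>
    teleportationKraus (W x.1) (W x.2) * (attachKraus ψ : Matrix _ (Fin d × Fin d) ℂ))
  rw [sum_teleportation_kraus hd hW] at h
  convert h using 1
  congr 1
  · rw [simulation, teleportation_eq_kraus, attach_vecMulVec_eq_kraus, kraus_comp_kraus]
    ext1 X
    simp only [kraus_apply, Fintype.sum_prod_type, Finset.univ_unique, Finset.sum_singleton]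
  · ext1 X
    simp only [LinearMap.smul_apply, kraus_apply, Finset.univ_unique, Finset.sum_singleton,
      swapChannel, LinearMap.coe_mk, AddHom.coe_mk, Matrix.conjTranspose_smul, Matrix.smul_mul,
      Matrix.mul_smul, smul_smul]
    congr 1
    rw [RCLike.star_def, Complex.conj_mul', norm_mul]
    simp
    field_simp

end Teleportation

/-! ### LOCC protocols for isotropic resources -/

section LOCCProtocols

variable {d D : ℕ}

theorem exists_isLOCC_isotropicState (hd : 1 ≤ d) (hD : 2 ≤ D) {F : ℝ} (hF0 : 0 ≤ F) (hF1 : F ≤ 1)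
    (hDd : D ≤ d ^ 2) :
    ∃ L : SuperOp ((Fin d × Fin D) × (Fin d × Fin D)) (Fin d × Fin d), IsLOCC L ∧
      IsCP (simulation L (isotropicState D F) -
        ((F * D / (d : ℝ) ^ 2 : ℝ) : ℂ) • swapChannel d) := by
  have hD0 : (D : ℂ) ≠ 0 := by exact_mod_cast (by omega : D ≠ 0)
  have hD1 : (0 : ℝ) < D := by exact_mod_cast (by omega : 0 < D)
  have hD' : (2 : ℝ) ≤ D := by exact_mod_cast hD
  -- Since D ≤ d², both parties can embed their half of the resource isometrically into two
  -- d-dimensional systems.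
  obtain ⟨ι⟩ : Nonempty (Fin D ↪ Fin d × Fin d) :=
    Function.Embedding.nonempty_of_card_le (by simpa [pow_two] using hDd)
  obtain ⟨L, hL, hψ⟩ := exists_isLOCC_sub_smul_swapChannel hd
  let J : Matrix (Fin d × Fin d) (Fin D) ℂ := Matrix.of fun p m => if p = ι m then 1 else 0
  have hJ : Jᴴ * J = 1 := by
    ext m m'
    simp [J, Matrix.mul_apply, Matrix.one_apply, ι.injective.eq_iff, eq_comm]
  have hE : IsChannel (kraus fun _ : Unit => J) := ⟨isCP_kraus_unit J, isTP_kraus_unit hJ⟩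
  have hE' : IsChannel (tensorMap (LinearMap.id : SuperOp (Fin d) (Fin d))
      (kraus fun _ : Unit => J)) := ⟨IsCP.id.tensor hE.1, IsTP.id.tensor hE.2⟩
  refine ⟨L ∘ₗ tensorMap _ _, hL.comp_tensorMap hE' hE', ?_⟩
  have h0 : ((1 - F : ℂ) / ((D : ℂ) ^ 2 - 1)) = (((1 - F) / ((D : ℝ) ^ 2 - 1) : ℝ) : ℂ) := by
    push_cast; rfl
  have h1 : IsCP (simulation (L ∘ₗ tensorMap (tensorMap (LinearMap.id : SuperOp (Fin d) (Fin d))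
      (kraus fun _ : Unit => J)) (tensorMap (LinearMap.id : SuperOp (Fin d) (Fin d))
      (kraus fun _ : Unit => J))) (maxEntangled D) -
        ((D / (d : ℝ) ^ 2 : ℝ) : ℂ) • swapChannel d) := by
    rw [maxEntangled_eq_vecMulVec, simulation_smul, simulation_comp_tensorMap, tensorMap_kraus,
      kraus_vecMulVec, Fintype.sum_prod_type, Fintype.sum_unique, Fintype.sum_unique]
    set φ : Fin D × Fin D → ℂ := fun p => if p.1 = p.2 then 1 else 0
    -- The unnormalized vector has overlap D, and Φ carries the factor 1/D, so the weight is (1/D) ·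
    -- D²/d² = D/d².
    have h2 : ∑ p, ((J ⊗ₖ J) *ᵥ φ) (p, p) = D := by
      simp only [Matrix.mulVec, dotProduct, Fintype.sum_prod_type (α₁ := Fin D), φ,
        Matrix.kroneckerMap_apply, mul_ite, mul_one, mul_zero, Finset.sum_ite_eq, Finset.mem_univ, if_true, J,
        Matrix.of_apply]
      rw [Finset.sum_comm]
      simp
    have h3 := (hψ ((J ⊗ₖ J) *ᵥ φ)).smul (t := 1 / D) (by positivity)
    rw [h2] at h3
    convert h3 using 1
    rw [smul_sub, smul_smul]
    congr 2
    · push_cast; rfl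
    · simp
      field_simp
  -- The component along 1 - Φ contributes only to the completely positive remainder.
  have h2 := ((hL.comp_tensorMap hE' hE').isCPPTP.1.1).comp
    (isCP_attach (a := Fin d) (b := Fin d) (posSemidef_one_sub_maxEntangled (D := D) (by omega)))
  have h3 := (h1.smul hF0).add (h2.smul (t := (1 - F) / ((D : ℝ) ^ 2 - 1))
    (div_nonneg (by linarith) (by nlinarith)))
  convert h3 using 1
  rw [isotropicState, simulation_add, simulation_smul, simulation_smul, h0, smul_sub, smul_smul,
    add_sub_right_comm]
  congr 3
  push_cast
  ring

/-- Both parties discard the resource and teleport with a fixed product vector, for which ∑ ψ(p,p) =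
1. -/
theorem exists_isLOCC_fidelity_one_div (hd : 1 ≤ d) {ρ : Op (Fin D × Fin D)} (hρ : IsState ρ) :
    ∃ L : SuperOp ((Fin d × Fin D) × (Fin d × Fin D)) (Fin d × Fin d), IsLOCC L ∧
      IsCP (simulation L ρ - ((1 / (d : ℝ) ^ 2 : ℝ) : ℂ) • swapChannel d) := by
  obtain ⟨L, hL, hψ⟩ := exists_isLOCC_sub_smul_swapChannel hd
  let o : Fin d × Fin d := (⟨0, hd⟩, ⟨0, hd⟩)
  let J : Fin D → Matrix (Fin d × Fin d) (Fin D) ℂ := fun m => Matrix.single o m 1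
  have hJ : ∑ m, (J m)ᴴ * J m = 1 := by
    simp [J, Matrix.conjTranspose_single, Matrix.sum_single_one]
  have hE : IsChannel (kraus J) := ⟨isCP_kraus J, isTP_kraus hJ⟩
  have hE' : IsChannel (tensorMap (LinearMap.id : SuperOp (Fin d) (Fin d)) (kraus J)) :=
    ⟨IsCP.id.tensor hE.1, IsTP.id.tensor hE.2⟩
  refine ⟨L ∘ₗ tensorMap _ _, hL.comp_tensorMap hE' hE', ?_⟩
  let ψ : (Fin d × Fin d) × (Fin d × Fin d) → ℂ := fun p => if p = (o, o) then 1 else 0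
  have h1 : tensorMap (kraus J) (kraus J) ρ = Matrix.vecMulVec ψ (star ψ) := by
    have hk : ∀ m m', kraus J (Matrix.single m m' 1) =
        if m = m' then Matrix.single o o (1 : ℂ) else 0 := by
      intro m m'
      rw [kraus_apply]
      split_ifs with h
      · subst h
        rw [Finset.sum_eq_single m]
        · simp [J, Matrix.conjTranspose_single]
        · intro k _ hk; simp [J, hk]
        · simp
      · refine Finset.sum_eq_zero fun k _ => ?_
        by_cases hk : k = m
        · subst hk; simp [J, Matrix.conjTranspose_single, Ne.symm h]
        · simp [J, hk]
    have h2 : Matrix.vecMulVec ψ (star ψ) = Matrix.single (o, o) (o, o) (1 : ℂ) := by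
      ext p q
      by_cases h1 : p = (o, o) <;> by_cases h2 : q = (o, o) <;>
        simp [Matrix.vecMulVec_apply, ψ, h1, h2, eq_comm]
    have h3 : ∀ p q : Fin D × Fin D, tensorMap (kraus J) (kraus J) (Matrix.single p q 1) =
        if p = q then Matrix.single (o, o) (o, o) (1 : ℂ) else 0 := by
      rintro ⟨m, n⟩ ⟨m', n'⟩
      rw [tensorMap_single, hk, hk]
      by_cases h1 : m = m' <;> by_cases h2 : n = n' <;>
        simp [h1, h2, Matrix.single_kronecker_single]
    rw [superOp_apply, h2]
    simp only [h3, smul_ite, smul_zero, Finset.sum_ite_eq, Finset.mem_univ, if_true,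
      ← Finset.sum_smul]
    have := hρ.2
    rw [Matrix.trace] at this
    simp only [Matrix.diag_apply] at this
    rw [this, one_smul]
  rw [simulation_comp_tensorMap, h1]
  convert hψ ψ using 5
  have : ∑ p, ψ (p, p) = 1 := by
    simp [ψ]
  rw [this]
  simp

end LOCCProtocols

/-! ### Contracting the resource with a test operator -/

section Contraction

variable {a b r s : Type} [Fintype a] [DecidableEq a] [Fintype b] [DecidableEq b]
  [Fintype r] [DecidableEq r] [Fintype s] [DecidableEq s]

/-- The map `X ↦ Tr_{r s} [X (1 ⊗ Q)]`, as a linear map in `Q`. -/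
def contraction {a b r s : Type} [Fintype r] [Fintype s] :
    Op (r × s) →ₗ[ℂ] SuperOp ((a × r) × (b × s)) (a × b) where
  toFun Q :=
    { toFun := fun X => Matrix.of fun z z' => ∑ p : r × s, ∑ p' : r × s,
        X ((z.1, p.1), (z.2, p.2)) ((z'.1, p'.1), (z'.2, p'.2)) * Q p' p
      map_add' := fun X Y => by
        ext; simp [add_mul, Finset.sum_add_distrib]
      map_smul' := fun c X => by
        ext; simp [Finset.mul_sum, mul_assoc] }
  map_add' Q R := by
    ext1 X; ext; simp [mul_add, Finset.sum_add_distrib]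
  map_smul' c Q := by
    ext1 X; ext; simp [Finset.mul_sum, mul_left_comm]

theorem contraction_apply (Q : Op (r × s)) (X : Op ((a × r) × (b × s))) (z z' : a × b) :
    contraction Q X z z' = ∑ p : r × s, ∑ p' : r × s,
        X ((z.1, p.1), (z.2, p.2)) ((z'.1, p'.1), (z'.2, p'.2)) * Q p' p := rfl

/-- Projecting the resource onto `w` is adjoint to appending `w`. -/
theorem contraction_vecMulVec (w : r × s → ℂ) :
    (contraction (Matrix.vecMulVec w (star w)) : SuperOp ((a × r) × (b × s)) (a × b)) =
      kraus (fun _ : Unit => (attachKraus w : Matrix _ (a × b) ℂ)ᴴ) := by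
  have h : ∀ f : (a × r) × (b × s) → ℂ, ∑ u, f u = ∑ z : a × b, ∑ p : r × s,
      f ((z.1, p.1), (z.2, p.2)) := by
    intro f
    rw [← Fintype.sum_prod_type' (f := fun (z : a × b) (p : r × s) => f ((z.1, p.1), (z.2, p.2)))]
    exact ((Equiv.prodProdProdComm a b r s).sum_comp f).symm
  ext1 X
  ext z z'
  simp only [contraction_apply, kraus_apply, Finset.univ_unique, Finset.sum_singleton,
    Matrix.conjTranspose_conjTranspose, Matrix.mul_apply, Matrix.conjTranspose_apply, h,
    attachKraus, Matrix.of_apply, apply_ite star, star_zero, mul_ite, ite_mul, mul_zero, zero_mul]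
  rw [Finset.sum_comm, Finset.sum_eq_single z']
  · refine Finset.sum_congr rfl fun p' _ => ?_
    rw [if_pos rfl, Finset.sum_eq_single z, Finset.sum_mul]
    · refine Finset.sum_congr rfl fun p _ => ?_
      rw [if_pos rfl, Matrix.vecMulVec_apply, Pi.star_apply]
      ring
    · intro y _ hy
      exact Finset.sum_eq_zero fun p _ => if_neg (Ne.symm hy)
    · simp
  · intro y _ hy
    exact Finset.sum_eq_zero fun p _ => if_neg (Ne.symm hy)
  · simp

theorem isCP_contraction {Q : Op (r × s)} (hQ : Q.PosSemidef) :
    IsCP (contraction Q : SuperOp ((a × r) × (b × s)) (a × b)) := by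
  obtain ⟨w, rfl⟩ := eq_sum_vecMulVec hQ
  rw [map_sum]
  refine IsCP.sum _ fun k _ => ?_
  rw [contraction_vecMulVec]
  exact isCP_kraus _

theorem trace_contraction_one (X : Op ((a × r) × (b × s))) :
    (contraction (1 : Op (r × s)) X : Op (a × b)).trace = X.trace := by
  simp only [Matrix.trace, Matrix.diag_apply, contraction_apply, Matrix.one_apply, mul_ite,
    mul_one, mul_zero, Finset.sum_ite_eq', Finset.mem_univ, if_true]
  rw [← Fintype.sum_prod_type' (f := fun (z : a × b) (p : r × s) =>
    X ((z.1, p.1), (z.2, p.2)) ((z.1, p.1), (z.2, p.2)))]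
  exact (Equiv.prodProdProdComm a b r s).sum_comp (fun u => X u u)

theorem contraction_comp_attach (Q ρ : Op (r × s)) :
    (contraction Q : SuperOp ((a × r) × (b × s)) (a × b)) ∘ₗ attach ρ =
      (ρ * Q).trace • LinearMap.id := by
  ext1 X
  ext z z'
  simp only [LinearMap.comp_apply, contraction_apply, attach_apply, LinearMap.smul_apply,
    LinearMap.id_apply, Matrix.smul_apply, smul_eq_mul, Matrix.trace, Matrix.diag_apply,
    Matrix.mul_apply, Finset.sum_mul]
  refine Finset.sum_congr rfl fun p _ => Finset.sum_congr rfl fun p' _ => ?_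
  ring

theorem partialTranspose_contraction (Q : Op (r × s)) :
    partialTranspose a b ∘ₗ contraction Q ∘ₗ partialTranspose (a × r) (b × s) =
      contraction (partialTranspose r s Q) := by
  ext1 X
  ext z z'
  simp only [LinearMap.comp_apply, partialTranspose_apply, contraction_apply,
    Fintype.sum_prod_type]
  refine Finset.sum_congr rfl fun p _ => ?_
  rw [Finset.sum_comm]
  conv_rhs => rw [Finset.sum_comm]
  refine Finset.sum_congr rfl fun p' _ => ?_
  rw [Finset.sum_comm]

end Contraction

/-! ### The C-PPT-P protocol for D > d² -/

section PPTProtocol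

variable {d D : ℕ}

/-- The completely depolarizing map `X ↦ (Tr X) 1`. -/
def traceOne (n : Type) [Fintype n] [DecidableEq n] : SuperOp n n where
  toFun X := X.trace • 1
  map_add' X Y := by rw [Matrix.trace_add, add_smul]
  map_smul' c X := by rw [Matrix.trace_smul, smul_assoc, RingHom.id_apply]

theorem traceOne_apply {n : Type} [Fintype n] [DecidableEq n] (X : Op n) :
    traceOne n X = X.trace • 1 := rfl

theorem sum_single_mul_mul_single {n : Type} [Fintype n] [DecidableEq n] (X : Op n) (i j k l : n) :
    Matrix.single i j 1 * X * Matrix.single k l 1 = X j k • Matrix.single i l (1 : ℂ) := by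
  rw [Matrix.single_mul_mul_single]
  simp

theorem traceOne_eq_kraus {n : Type} [Fintype n] [DecidableEq n] :
    traceOne n = kraus (fun x : n × n => Matrix.single x.2 x.1 (1 : ℂ)) := by
  ext1 X
  simp only [kraus_apply, Matrix.conjTranspose_single, star_one, sum_single_mul_mul_single,
    Fintype.sum_prod_type, ← Finset.smul_sum]
  rw [← Finset.sum_smul, traceOne_apply, Matrix.sum_single_one]
  rfl

theorem swapOp_eq_sum (d : ℕ) :
    swapOp d = ∑ z : Fin d × Fin d, Matrix.single z.swap z (1 : ℂ) := by
  ext p q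
  rw [swapOp_apply, Matrix.sum_apply, Finset.sum_eq_single q]
  · simp [Matrix.single_apply, eq_comm]
  · intro z _ hz; simp [hz]
  · simp

/-- Among the matrix units that are Kraus operators of `traceOne`, the d² units |z.swap⟩⟨z| add up
to the swap, so averaging them yields the weight 1/d². -/
theorem isCP_traceOne_sub_swapChannel (hd : 1 ≤ d) :
    IsCP (traceOne (Fin d × Fin d) - (1 / (d : ℂ) ^ 2) • swapChannel d) := by
  have : NeZero d := ⟨by omega⟩
  have h := isCP_kraus_sub (fun z : Fin d × Fin d => Matrix.single z.swap z (1 : ℂ))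
  have h2 := h.add (isCP_kraus (fun x : (Fin d × Fin d) × (Fin d × Fin d) =>
    if x.2 = x.1.swap then 0 else Matrix.single x.2 x.1 (1 : ℂ)))
  rw [← swapOp_eq_sum] at h2
  convert h2 using 1
  rw [sub_add_eq_add_sub]
  congr 1
  · rw [traceOne_eq_kraus]
    ext1 X
    simp only [LinearMap.add_apply, kraus_apply, Fintype.sum_prod_type (α₁ := Fin d × Fin d)]
    rw [← Finset.sum_add_distrib]
    refine Finset.sum_congr rfl fun z _ => ?_
    rw [← Finset.sum_erase_add _ _ (Finset.mem_univ z.swap), add_comm]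
    congr 1
    rw [← Finset.sum_erase_add (a := z.swap) Finset.univ _ (Finset.mem_univ z.swap)]
    simp only [if_true, Matrix.zero_mul, add_zero]
    refine Finset.sum_congr rfl fun o ho => ?_
    rw [if_neg (Finset.ne_of_mem_erase ho)]
  · congr 1
    · simp [pow_two]
    · ext1 X
      simp [kraus_apply, swapChannel]

theorem partialTranspose_swapChannel_apply (X : Op (Fin d × Fin d)) (p q : Fin d × Fin d) :
    (partialTranspose (Fin d) (Fin d) ∘ₗ swapChannel d ∘ₗ partialTranspose (Fin d) (Fin d)) X p q =
      X q.swap p.swap := by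
  simp only [LinearMap.comp_apply, partialTranspose_apply, swapChannel_apply]
  rfl

/-- The Choi operator is 1 + ε times a flip, hence positive. Its Kraus operators are
(anti)symmetrized matrix units; the factor 1/2 compensates for listing each pair twice. -/
theorem isCP_traceOne_add_smul {ε : ℝ} (hε : ε ^ 2 = 1) :
    IsCP (traceOne (Fin d × Fin d) + (ε : ℂ) • (partialTranspose (Fin d) (Fin d) ∘ₗ
      swapChannel d ∘ₗ partialTranspose (Fin d) (Fin d))) := by
  have hε' : (ε : ℂ) * ε = 1 := by rw [← pow_two]; exact_mod_cast hε
  have h := (isCP_kraus (fun x : (Fin d × Fin d) × (Fin d × Fin d) =>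
    Matrix.single x.2 x.1 (1 : ℂ) + (ε : ℂ) • Matrix.single x.1.swap x.2.swap (1 : ℂ))).smul
      (t := 1 / 2) (by norm_num)
  convert h using 1
  ext1 X
  have h1 : ∀ z o : Fin d × Fin d,
      (Matrix.single o z (1 : ℂ) + (ε : ℂ) • Matrix.single z.swap o.swap (1 : ℂ)) * X *
      (Matrix.single o z (1 : ℂ) + (ε : ℂ) • Matrix.single z.swap o.swap (1 : ℂ))ᴴ =
      X z z • Matrix.single o o (1 : ℂ) + X o.swap o.swap • Matrix.single z.swap z.swap (1 : ℂ) +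
      (ε : ℂ) • (X z o.swap • Matrix.single o z.swap (1 : ℂ)) +
      (ε : ℂ) • (X o.swap z • Matrix.single z.swap o (1 : ℂ)) := by
    intro z o
    rw [Matrix.conjTranspose_add, Matrix.conjTranspose_smul, Matrix.conjTranspose_single,
      Matrix.conjTranspose_single, star_one, RCLike.star_def, Complex.conj_ofReal]
    simp only [Matrix.add_mul, Matrix.mul_add, Matrix.smul_mul, Matrix.mul_smul, smul_smul,
      sum_single_mul_mul_single, smul_add, ← mul_assoc, hε', one_mul]
    abel
  simp only [LinearMap.add_apply, LinearMap.smul_apply, kraus_apply, h1,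
    Fintype.sum_prod_type (α₁ := Fin d × Fin d), Finset.sum_add_distrib, ← Finset.smul_sum]
  have e1 : ∑ z : Fin d × Fin d, X z z • ∑ o : Fin d × Fin d, Matrix.single o o (1 : ℂ) =
      traceOne _ X := by
    rw [← Finset.sum_smul, Matrix.sum_single_one]; rfl
  have e2 : ∑ z : Fin d × Fin d, ∑ o : Fin d × Fin d,
      X o.swap o.swap • Matrix.single z.swap z.swap (1 : ℂ) = traceOne _ X := by
    rw [Finset.sum_comm, ← e1, ← (Equiv.prodComm (Fin d) (Fin d)).sum_comp]
    refine Finset.sum_congr rfl fun z _ => ?_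
    rw [← Finset.smul_sum]
    congr 1
    exact (Equiv.prodComm (Fin d) (Fin d)).sum_comp (fun o => Matrix.single o o (1 : ℂ))
  have e3 : ∑ z : Fin d × Fin d, ∑ o : Fin d × Fin d,
      X z o.swap • Matrix.single o z.swap (1 : ℂ) = (partialTranspose (Fin d) (Fin d) ∘ₗ
      swapChannel d ∘ₗ partialTranspose (Fin d) (Fin d)) X := by
    ext p q
    rw [partialTranspose_swapChannel_apply, Matrix.sum_apply, Finset.sum_eq_single q.swap,
      Matrix.sum_apply, Finset.sum_eq_single p]
    · simp
    · intro o _ ho; simp [ho]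
    · simp
    · intro z _ hz
      rw [Matrix.sum_apply]
      refine Finset.sum_eq_zero fun o _ => ?_
      have : z.swap ≠ q := fun h => hz (by rw [← h, Prod.swap_swap])
      simp [this]
    · simp
  have e4 : ∑ z : Fin d × Fin d, ∑ o : Fin d × Fin d,
      X o.swap z • Matrix.single z.swap o (1 : ℂ) = (partialTranspose (Fin d) (Fin d) ∘ₗ
      swapChannel d ∘ₗ partialTranspose (Fin d) (Fin d)) X := by
    rw [← e3, Finset.sum_comm, ← (Equiv.prodComm (Fin d) (Fin d)).sum_comp]
    refine Finset.sum_congr rfl fun z _ => ?_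
    rw [← (Equiv.prodComm (Fin d) (Fin d)).sum_comp]
    simp
  rw [e1, e2, e3, e4]
  push_cast
  module

/-- A combination of the cases ε = ±1 with nonnegative weights (β ± α) / 2. -/
theorem isCP_smul_add_smul_traceOne {α β : ℝ} (h : |α| ≤ β) :
    IsCP ((α : ℂ) • (partialTranspose (Fin d) (Fin d) ∘ₗ swapChannel d ∘ₗ
      partialTranspose (Fin d) (Fin d)) + (β : ℂ) • traceOne (Fin d × Fin d)) := by
  obtain ⟨h1, h2⟩ := abs_le.1 h
  have := ((isCP_traceOne_add_smul (d := d) (ε := 1) (by norm_num)).smul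
    (t := (β + α) / 2) (by linarith)).add
    ((isCP_traceOne_add_smul (d := d) (ε := -1) (by norm_num)).smul
    (t := (β - α) / 2) (by linarith))
  convert this using 1
  push_cast
  module

/-- The channel that applies the swap if the resource passes the test `maxEntangled`, and
`x • swapChannel + y • traceOne` otherwise. -/
def testAndSwap (d D : ℕ) (x y : ℝ) :
    SuperOp ((Fin d × Fin D) × (Fin d × Fin D)) (Fin d × Fin d) :=
  swapChannel d ∘ₗ contraction (maxEntangled D) +
    ((x : ℂ) • swapChannel d + (y : ℂ) • traceOne (Fin d × Fin d)) ∘ₗ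
      contraction (1 - maxEntangled D)

/-- Partial transposition turns the tests Φ and 1 - Φ into S/D and 1 - S/D, with S the swap operator
of the resource. These are diagonal on the symmetric and antisymmetric subspaces, and `h1`, `h2` are
the conditions of `isCP_smul_add_smul_traceOne` there. Trace preservation is `hxy`. -/
theorem isCPPTP_testAndSwap (hd : 1 ≤ d) (hD : 2 ≤ D) {x y : ℝ} (hxy : x + d ^ 2 * y = 1)
    (hy : 0 ≤ y) (hx : 0 ≤ x + y / d ^ 2)
    (h1 : |1 / D + (1 - 1 / D) * x| ≤ (1 - 1 / D) * y)
    (h2 : |-(1 / D) + (1 + 1 / D) * x| ≤ (1 + 1 / D) * y) :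
    IsCPPTP (testAndSwap d D x y) := by
  have hd0 : (d : ℂ) ≠ 0 := by exact_mod_cast (by omega : d ≠ 0)
  have hD0 : (D : ℂ) ≠ 0 := by exact_mod_cast (by omega : D ≠ 0)
  refine ⟨⟨?_, fun X => ?_⟩, ?_⟩
  · refine ((isChannel_swapChannel d).1.comp (isCP_contraction (posSemidef_maxEntangled D))).add
      (IsCP.comp ?_ (isCP_contraction (posSemidef_one_sub_maxEntangled (by omega))))
    -- The failure branch is (x + y/d²) · swap + y · (traceOne - swap/d²).
    convert ((isChannel_swapChannel d).1.smul hx).add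
      ((isCP_traceOne_sub_swapChannel hd).smul hy) using 1
    push_cast
    module
  · have hM : ∀ Y : Op (Fin d × Fin d),
        (((x : ℂ) • swapChannel d + (y : ℂ) • traceOne (Fin d × Fin d)) Y).trace = Y.trace := by
      intro Y
      rw [LinearMap.add_apply, LinearMap.smul_apply, LinearMap.smul_apply, Matrix.trace_add,
        Matrix.trace_smul, Matrix.trace_smul, (isChannel_swapChannel d).2, traceOne_apply,
        Matrix.trace_smul, trace_one_prod]
      simp only [smul_eq_mul]
      have : (x : ℂ) + d ^ 2 * y = 1 := by exact_mod_cast hxy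
      linear_combination Y.trace * this
    rw [testAndSwap, LinearMap.add_apply, LinearMap.comp_apply, LinearMap.comp_apply,
      Matrix.trace_add, (isChannel_swapChannel d).2, hM, ← Matrix.trace_add,
      ← LinearMap.add_apply, ← map_add, add_sub_cancel, trace_contraction_one]
  · have hPT : partialTranspose (Fin D) (Fin D) (maxEntangled D) = (1 / D : ℂ) • swapOp D := by
      have h := DFunLike.congr_fun (partialTranspose_comp_self (Fin D) (Fin D)) (swapOp D)
      rw [LinearMap.comp_apply, partialTranspose_swapOp (by omega), map_smul,
        LinearMap.id_apply] at h
      rw [← h, smul_smul, one_div, inv_mul_cancel₀ hD0, one_smul]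
    have hT : partialTranspose (Fin d) (Fin d) ∘ₗ traceOne (Fin d × Fin d) ∘ₗ
        partialTranspose (Fin d) (Fin d) = traceOne (Fin d × Fin d) := by
      ext1 X
      rw [LinearMap.comp_apply, LinearMap.comp_apply, traceOne_apply, map_smul,
        partialTranspose_one, isTP_partialTranspose, traceOne_apply]
    have e1 := ((isCP_smul_add_smul_traceOne (d := d) h1).comp (isCP_contraction (a := Fin d)
      (b := Fin d) (posSemidef_one_add_smul_swapOp D (ε := 1) (by norm_num)))).smul
      (t := 1 / 2) (by norm_num)
    have e2 := ((isCP_smul_add_smul_traceOne (d := d) h2).comp (isCP_contraction (a := Fin d)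
      (b := Fin d) (posSemidef_one_add_smul_swapOp D (ε := -1) (by norm_num)))).smul
      (t := 1 / 2) (by norm_num)
    have e3 : partialTranspose (Fin d) (Fin d) ∘ₗ testAndSwap d D x y ∘ₗ
        partialTranspose (Fin d × Fin D) (Fin d × Fin D) =
        partialTranspose (Fin d) (Fin d) ∘ₗ (swapChannel d ∘ₗ contraction (maxEntangled D)) ∘ₗ
          partialTranspose (Fin d × Fin D) (Fin d × Fin D) +
        partialTranspose (Fin d) (Fin d) ∘ₗ
          (((x : ℂ) • swapChannel d + (y : ℂ) • traceOne (Fin d × Fin d)) ∘ₗ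
            contraction (1 - maxEntangled D)) ∘ₗ
          partialTranspose (Fin d × Fin D) (Fin d × Fin D) := by
      ext1 X
      simp [testAndSwap]
    have e4 : partialTranspose (Fin d) (Fin d) ∘ₗ
        ((x : ℂ) • swapChannel d + (y : ℂ) • traceOne (Fin d × Fin d)) ∘ₗ
          partialTranspose (Fin d) (Fin d) =
        (x : ℂ) • (partialTranspose (Fin d) (Fin d) ∘ₗ swapChannel d ∘ₗ
          partialTranspose (Fin d) (Fin d)) + (y : ℂ) • traceOne (Fin d × Fin d) := by
      conv_rhs => rw [← hT]
      ext1 X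
      simp
    rw [e3, partialTranspose_comp_comp, partialTranspose_comp_comp, partialTranspose_contraction,
      partialTranspose_contraction, e4, map_sub, partialTranspose_one, hPT]
    convert e1.add e2 using 1
    ext1 X
    simp only [map_sub, map_add, map_smul, LinearMap.add_apply, LinearMap.sub_apply,
      LinearMap.smul_apply, LinearMap.comp_apply]
    push_cast
    module

theorem simulation_testAndSwap {x y : ℝ} {F : ℝ} (hD : 2 ≤ D) :
    simulation (testAndSwap d D x y) (isotropicState D F) =
      (F : ℂ) • swapChannel d + (1 - F : ℂ) • ((x : ℂ) • swapChannel d +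
        (y : ℂ) • traceOne (Fin d × Fin d)) := by
  have hD' : (2 : ℝ) ≤ D := by exact_mod_cast hD
  have h0 : (D : ℂ) ^ 2 - 1 ≠ 0 := by
    have : (D : ℝ) ^ 2 - 1 ≠ 0 := by nlinarith
    exact_mod_cast this
  have h1 : (isotropicState D F * maxEntangled D).trace = F := by
    rw [isotropicState, add_mul, smul_mul_assoc, smul_mul_assoc, sub_mul, one_mul,
      maxEntangled_mul_self (by omega), sub_self, smul_zero, add_zero, Matrix.trace_smul,
      trace_maxEntangled (by omega), smul_eq_mul, mul_one]
  have h2 : (isotropicState D F * (1 - maxEntangled D)).trace = 1 - F := by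
    rw [mul_sub, mul_one, Matrix.trace_sub, h1, isotropicState, Matrix.trace_add,
      Matrix.trace_smul, Matrix.trace_smul, Matrix.trace_sub, trace_maxEntangled (by omega),
      trace_one_prod]
    simp only [smul_eq_mul]
    field_simp
    ring
  rw [simulation, testAndSwap, LinearMap.add_comp, LinearMap.comp_assoc, LinearMap.comp_assoc,
    contraction_comp_attach, contraction_comp_attach, h1, h2, LinearMap.comp_smul,
    LinearMap.comp_smul, LinearMap.comp_id, LinearMap.comp_id]

theorem exists_isCPPTP_isotropicState (hd : 1 ≤ d) (hD : 2 ≤ D) (hDd : d ^ 2 < D) {F : ℝ}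
    (hF1 : F ≤ 1) :
    ∃ P : SuperOp ((Fin d × Fin D) × (Fin d × Fin D)) (Fin d × Fin d), IsCPPTP P ∧
      IsCP (simulation P (isotropicState D F) -
        ((1 - (1 - 1 / (d : ℝ) ^ 2) * (1 - F) / (1 - 1 / (D : ℝ)) : ℝ) : ℂ) • swapChannel d) := by
  have hd' : (1 : ℝ) ≤ d := by exact_mod_cast hd
  have hD' : (2 : ℝ) ≤ D := by exact_mod_cast hD
  have hDd' : (d : ℝ) ^ 2 ≤ D := by exact_mod_cast hDd.le
  have p1 : (0 : ℝ) < D - 1 := by linarith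
  have p2 : (0 : ℝ) < (d : ℝ) ^ 2 + 1 := by positivity
  have p3 : (0 : ℝ) < (d : ℝ) ^ 2 := by positivity
  have p4 : (0 : ℝ) < D := by linarith
  -- The solution of x + d²y = 1 and y - x = 1/(D - 1); the second equation makes the symmetric PPT
  -- constraint tight.
  set y : ℝ := D / ((D - 1) * (d ^ 2 + 1)) with hy
  set x : ℝ := 1 - d ^ 2 * y with hx
  have hy0 : 0 ≤ y := by positivity
  have ey : (D - 1) * ((d : ℝ) ^ 2 + 1) * y = D := by rw [hy]; field_simp
  have ex : (1 - 1 / (D : ℝ)) * (y - x) = 1 / D := by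
    rw [hx]
    field_simp
    linear_combination ey
  have hq : 1 - (x + y / d ^ 2) = (1 - 1 / (d : ℝ) ^ 2) / (1 - 1 / D) := by
    rw [hx, hy, show 1 - 1 / (D : ℝ) = (D - 1) / D by field_simp]
    field_simp
    ring
  refine ⟨testAndSwap d D x y, isCPPTP_testAndSwap hd hD (by rw [hx]; ring) hy0 ?_ ?_ ?_, ?_⟩
  -- The weight of the swap in the failure branch is nonnegative because d² ≤ D.
  · have : x + y / d ^ 2 = (D - d ^ 2) / ((D - 1) * d ^ 2) := by
      rw [hx, hy]; field_simp; ring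
    rw [this]
    exact div_nonneg (by linarith) (by positivity)
  · have h1 : (0 : ℝ) ≤ (1 - 1 / D) * y :=
      mul_nonneg (sub_nonneg.2 ((div_le_one p4).2 (by linarith))) hy0
    rw [abs_le]
    constructor <;> linarith
  · have h1 : y - x = 1 / (D - 1) := by
      rw [eq_div_iff p1.ne']
      field_simp at ex
      linarith
    -- After clearing denominators this is d² ≤ D; it gives the lower half of the antisymmetric
    -- constraint.
    have h2 : D / (D - 1) ≤ (D + 1) * y := by
      rw [hy, ← mul_div_assoc, div_le_div_iff₀ p1 (by positivity)]
      nlinarith [mul_nonneg (mul_nonneg p4.le p1.le) (sub_nonneg.2 hDd')]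
    have h3 : (1 : ℝ) ≤ (D + 1) * (x + y) := by
      have h4 : (D + 1) * (x + y) = 2 * ((D + 1) * y) - (D + 1) * (1 / (D - 1)) := by
        rw [← h1]; ring
      have h5 : 2 * ((D : ℝ) / (D - 1)) - (D + 1) * (1 / (D - 1)) = 1 := by
        field_simp
        ring
      linarith
    have h6 : (1 + 1 / (D : ℝ)) * (x + y) = (D + 1) * (x + y) / D := by
      field_simp
    have h7 : 1 / (D : ℝ) ≤ (1 + 1 / (D : ℝ)) * (x + y) := by
      rw [h6]
      gcongr
    have h8 : (0 : ℝ) ≤ (1 + 1 / (D : ℝ)) * (y - x) := by rw [h1]; positivity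
    have h9 : (0 : ℝ) ≤ 1 / (D : ℝ) := by positivity
    rw [abs_le]
    constructor <;> linarith
  · rw [simulation_testAndSwap hD]
    convert (isCP_traceOne_sub_swapChannel hd).smul (t := (1 - F) * y)
      (mul_nonneg (by linarith) hy0) using 1
    have h : 1 - (1 - 1 / (d : ℝ) ^ 2) * (1 - F) / (1 - 1 / (D : ℝ)) =
        F + (1 - F) * (x + y / d ^ 2) := by
      rw [mul_div_right_comm, ← hq]
      ring
    rw [h]
    push_cast
    module

end PPTProtocol

/-! ### Assembling the simulation errors -/

section Errors

variable {d D : ℕ}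

theorem half_diamondDist_le {F : ℝ} (hD : 2 ≤ D) (hF0 : 0 ≤ F) (hF1 : F ≤ 1)
    {P : SuperOp ((Fin d × Fin D) × (Fin d × Fin D)) (Fin d × Fin d)} (hP : IsCPPTP P) {p : ℝ}
    (hp : p ≤ 1)
    (h : IsCP (simulation P (isotropicState D F) - (p : ℂ) • swapChannel d)) :
    1 / 2 * diamondDist (swapChannel d) (simulation P (isotropicState D F)) ≤ 1 - p := by
  have := diamondDist_le_of_eq_smul_add (isChannel_swapChannel d)
    (isChannel_simulation hP.1 (isState_isotropicState hD hF0 hF1)).2 h hp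
    (add_sub_cancel _ _).symm
  linarith

theorem le_half_diamondDist (hd : 1 ≤ d) {F : ℝ} (hD : 2 ≤ D) (hF0 : 0 ≤ F) (hF1 : F ≤ 1)
    {P : SuperOp ((Fin d × Fin D) × (Fin d × Fin D)) (Fin d × Fin d)} (hP : IsCPPTP P) {p : ℝ}
    (h : (simulationFidelity P (isotropicState D F)).re ≤ p) :
    1 - p ≤ 1 / 2 * diamondDist (swapChannel d) (simulation P (isotropicState D F)) := by
  have h1 := le_diamondDist_swapChannel hd
    (isChannel_simulation hP.1 (isState_isotropicState hD hF0 hF1))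
  have h2 : (swapFidelity (simulation P (isotropicState D F))).re ≤ p := h
  linarith

/-- The same `p` bounds every fidelity and is the swap weight of one protocol, so the infimum is
attained there. -/
theorem errPPT_eq (hd : 1 ≤ d) {F : ℝ} (hD : 2 ≤ D) (hF0 : 0 ≤ F) (hF1 : F ≤ 1) {p : ℝ}
    (hp : p ≤ 1)
    (hle : ∀ P : SuperOp ((Fin d × Fin D) × (Fin d × Fin D)) (Fin d × Fin d), IsCPPTP P →
      (simulationFidelity P (isotropicState D F)).re ≤ p)
    (hex : ∃ P : SuperOp ((Fin d × Fin D) × (Fin d × Fin D)) (Fin d × Fin d), IsCPPTP P ∧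
      IsCP (simulation P (isotropicState D F) - (p : ℂ) • swapChannel d)) :
    errPPT (swapChannel d) (isotropicState D F) = 1 - p := by
  obtain ⟨P, hP, hPp⟩ := hex
  refine IsLeast.csInf_eq ⟨⟨P, hP, le_antisymm ?_ ?_⟩, ?_⟩
  · exact le_half_diamondDist hd hD hF0 hF1 hP (hle P hP)
  · exact half_diamondDist_le hD hF0 hF1 hP hp hPp
  · rintro e ⟨P, hP, rfl⟩
    exact le_half_diamondDist hd hD hF0 hF1 hP (hle P hP)

theorem errLOCC_eq (hd : 1 ≤ d) {F : ℝ} (hD : 2 ≤ D) (hF0 : 0 ≤ F) (hF1 : F ≤ 1) {p : ℝ}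
    (hp : p ≤ 1)
    (hle : ∀ P : SuperOp ((Fin d × Fin D) × (Fin d × Fin D)) (Fin d × Fin d), IsCPPTP P →
      (simulationFidelity P (isotropicState D F)).re ≤ p)
    (hex : ∃ L : SuperOp ((Fin d × Fin D) × (Fin d × Fin D)) (Fin d × Fin d), IsLOCC L ∧
      IsCP (simulation L (isotropicState D F) - (p : ℂ) • swapChannel d)) :
    errLOCC (swapChannel d) (isotropicState D F) = 1 - p := by
  obtain ⟨L, hL, hLp⟩ := hex
  refine IsLeast.csInf_eq ⟨⟨L, hL, le_antisymm ?_ ?_⟩, ?_⟩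
  · exact le_half_diamondDist hd hD hF0 hF1 hL.isCPPTP (hle L hL.isCPPTP)
  · exact half_diamondDist_le hD hF0 hF1 hL.isCPPTP hp hLp
  · rintro e ⟨L, hL, rfl⟩
    exact le_half_diamondDist hd hD hF0 hF1 hL.isCPPTP (hle L hL.isCPPTP)

theorem err_of_le (hd : 1 ≤ d) {F : ℝ} (hD : 2 ≤ D) (hF0 : 0 ≤ F) (hF1 : F ≤ 1)
    (hF : F ≤ 1 / (D : ℝ)) :
    errPPT (swapChannel d) (isotropicState D F) = 1 - 1 / (d : ℝ) ^ 2 ∧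
      errLOCC (swapChannel d) (isotropicState D F) = 1 - 1 / (d : ℝ) ^ 2 := by
  have hd' : (1 : ℝ) ≤ d := by exact_mod_cast hd
  have hp : 1 / (d : ℝ) ^ 2 ≤ 1 := (div_le_one (by positivity)).2 (one_le_pow₀ hd')
  have hle : ∀ P : SuperOp ((Fin d × Fin D) × (Fin d × Fin D)) (Fin d × Fin d), IsCPPTP P →
      (simulationFidelity P (isotropicState D F)).re ≤ 1 / (d : ℝ) ^ 2 := by
    intro P hP
    obtain ⟨t, v, -, -, h1, h2, h⟩ := exists_simulationFidelity_isotropicState_eq hd hD hP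
    rw [h]
    exact fidelity_le_of_le (by exact_mod_cast hD) hd' hF hF0 h1 h2
  obtain ⟨L, hL, hLp⟩ := exists_isLOCC_fidelity_one_div hd (isState_isotropicState hD hF0 hF1)
  exact ⟨errPPT_eq hd hD hF0 hF1 hp hle ⟨L, hL.isCPPTP, hLp⟩,
    errLOCC_eq hd hD hF0 hF1 hp hle ⟨L, hL, hLp⟩⟩

theorem err_of_lt_of_le (hd : 1 ≤ d) {F : ℝ} (hD : 2 ≤ D) (hF0 : 0 ≤ F) (hF1 : F ≤ 1)
    (hF : 1 / (D : ℝ) < F) (hDd : D ≤ d ^ 2) :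
    errPPT (swapChannel d) (isotropicState D F) = 1 - F * D / (d : ℝ) ^ 2 ∧
      errLOCC (swapChannel d) (isotropicState D F) = 1 - F * D / (d : ℝ) ^ 2 := by
  have hd' : (1 : ℝ) ≤ d := by exact_mod_cast hd
  have hDd' : (D : ℝ) ≤ (d : ℝ) ^ 2 := by exact_mod_cast hDd
  have hp : F * D / (d : ℝ) ^ 2 ≤ 1 := by
    refine (div_le_one (by positivity)).2 (le_trans ?_ hDd')
    exact mul_le_of_le_one_left (Nat.cast_nonneg D) hF1
  have hle : ∀ P : SuperOp ((Fin d × Fin D) × (Fin d × Fin D)) (Fin d × Fin d), IsCPPTP P →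
      (simulationFidelity P (isotropicState D F)).re ≤ F * D / (d : ℝ) ^ 2 := by
    intro P hP
    obtain ⟨t, v, -, -, h1, h2, h⟩ := exists_simulationFidelity_isotropicState_eq hd hD hP
    rw [h]
    exact fidelity_le_of_lt (by exact_mod_cast hD) hd' hF h1 h2
  obtain ⟨L, hL, hLp⟩ := exists_isLOCC_isotropicState hd hD hF0 hF1 hDd
  exact ⟨errPPT_eq hd hD hF0 hF1 hp hle ⟨L, hL.isCPPTP, hLp⟩,
    errLOCC_eq hd hD hF0 hF1 hp hle ⟨L, hL, hLp⟩⟩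

theorem errPPT_of_lt_of_lt (hd : 1 ≤ d) {F : ℝ} (hD : 2 ≤ D) (hF0 : 0 ≤ F) (hF1 : F ≤ 1)
    (hF : 1 / (D : ℝ) < F) (hDd : d ^ 2 < D) :
    errPPT (swapChannel d) (isotropicState D F) =
      (1 - 1 / (d : ℝ) ^ 2) * (1 - F) / (1 - 1 / (D : ℝ)) := by
  have hd' : (1 : ℝ) ≤ d := by exact_mod_cast hd
  have hD' : (2 : ℝ) ≤ D := by exact_mod_cast hD
  have hp : 1 - (1 - 1 / (d : ℝ) ^ 2) * (1 - F) / (1 - 1 / (D : ℝ)) ≤ 1 := by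
    refine sub_le_self _ (div_nonneg (mul_nonneg (sub_nonneg.2 ?_) (sub_nonneg.2 hF1))
      (sub_nonneg.2 ?_))
    · exact (div_le_one (by positivity)).2 (one_le_pow₀ hd')
    · exact (div_le_one (by linarith)).2 (by linarith)
  have h := errPPT_eq hd hD hF0 hF1 hp (fun P hP => by
    obtain ⟨t, v, -, hv, h1, -, h⟩ := exists_simulationFidelity_isotropicState_eq hd hD hP
    rw [h]
    exact fidelity_le_of_lt_of_le_one hD' hd' hF hF1 hv h1)
    (exists_isCPPTP_isotropicState hd hD hDd hF1)
  rw [h, sub_sub_cancel]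

end Errors

end Teleport

end

theorem mainTheorem5 (d D : ℕ) (hd : 1 ≤ d) (hD : 2 ≤ D) (F : ℝ) (hF0 : 0 ≤ F) (hF1 : F ≤ 1) :
    (F ≤ 1 / (D : ℝ) →
      Teleport.errPPT (Teleport.swapChannel d) (Teleport.isotropicState D F) =
        1 - 1 / (d : ℝ) ^ 2) ∧
    (1 / (D : ℝ) < F → D ≤ d ^ 2 →
      Teleport.errPPT (Teleport.swapChannel d) (Teleport.isotropicState D F) =
        1 - F * (D : ℝ) / (d : ℝ) ^ 2) ∧
    (1 / (D : ℝ) < F → d ^ 2 < D →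
      Teleport.errPPT (Teleport.swapChannel d) (Teleport.isotropicState D F) =
        (1 - 1 / (d : ℝ) ^ 2) * (1 - F) / (1 - 1 / (D : ℝ))) ∧
    (F ≤ 1 / (D : ℝ) ∨ (1 / (D : ℝ) < F ∧ D ≤ d ^ 2) →
      Teleport.errPPT (Teleport.swapChannel d) (Teleport.isotropicState D F) =
        Teleport.errLOCC (Teleport.swapChannel d) (Teleport.isotropicState D F)) := by
  refine ⟨fun h => (Teleport.err_of_le hd hD hF0 hF1 h).1,
    fun h h' => (Teleport.err_of_lt_of_le hd hD hF0 hF1 h h').1,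
    fun h h' => Teleport.errPPT_of_lt_of_lt hd hD hF0 hF1 h h', ?_⟩
  rintro (h | ⟨h, h'⟩)
  · obtain ⟨h1, h2⟩ := Teleport.err_of_le hd hD hF0 hF1 h
    rw [h1, h2]
  · obtain ⟨h1, h2⟩ := Teleport.err_of_lt_of_le hd hD hF0 hF1 h h'
    rw [h1, h2]
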